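/- Let $\mathcal E$ be a model of extensional dependent type theory: a category with families, with terminal context $1$, supporting (stably under reindexing) dependent products and sums, extensional identity types, a unit type, finite colimits (empty type $\bot$, binary coproducts, coequalisers), natural numbers $\mathbb N$ and propositional truncation $\|-\|$, in which every context is isomorphic to $1.X$ for some closed type $X$. Suppose $\mathcal E$ has an interval $1\vdash\mathbb I$ with end points $0,1$ and connections $\sqcap,\sqcup$, and a type $\mathsf{Cof}$ of cofibrant propositions $[\varphi]$, satisfying the Orton–Pitts axioms $\mathtt{ax}_1$–$\mathtt{ax}_8$ and propositional extensionality for $\mathsf{Cof}$, and suppose that the exponential functor $(-)^{\mathbb I}$ on contexts has a right adjoint. (Every model $\mathcal E$ underlying an Orton–Pitts model has this structure; its universes, axiom $\mathtt{ax}_9$ and cofibrant $W$-types with reductions are not needed here.) Let $\widehat{\mathcal E}$ denote the associated cubical interpretation: its contexts are those of $\mathcal E$, its types $\Gamma\vdash_{\widehat{\mathcal E}}X$ are the types $\Gamma\vdash_{\mathcal E}X$ equipped with a fibration (uniform composition) structure, its elements are the elements of the underlying types, and its identity type $\mathrm{Id}_X(x,y)$ consists of a path $p:\mathbb I\to X$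 with $p0=x$, $p1=y$ together with a cofibrant proposition $\varphi$ such that $[\varphi]$ implies $p\,i=x$ for all $i$. Propositions and $\mathsf{isEquiv}$ are formed with these identity types. Let $1\vdash_{\widehat{\mathcal E}}A$ and let $a:A\vdash_{\widehat{\mathcal E}}B(a)$ be a proposition (any two elements of $B(a)$ are identified in $\widehat{\mathcal E}$) that is well-supported: the truncation $a:A\vdash_{\mathcal E}\|B(a)\|$, taken in $\mathcal E$, is inhabited. For a type $\Gamma\vdash X$ put $$\mathsf{isNull}_B(X):=\prod_{a:A}\mathsf{isEquiv}\bigl(\lambda(x:X).\lambda(b:B(a)).x\bigr).$$ A $B$-null structure on $X$ is an element of $\Gamma\vdash\mathsf{isNull}_B(X)$. A closed type $1\vdash_{\mathcal E}X$ is discrete if $\lambda x.\lambda i.x:X\to X^{\mathbb I}$ is an isomorphism. Then: 1. Every discrete type $1\vdash_{\mathcal E}X$ carries a fibration structure and has a $B$-null structure. 2. $\mathbb N$ and $\bot$ are discrete and have $B$-null structures. 3. For every context $\Gamma$ and all types $X,Y$ of $\widehat{\mathcal E}$ over $\Gamma$, there is an element of $$\Gamma\vdash\mathsf{isNull}_B(X)\to\mathsf{isNull}_B(Y)\to\mathsf{isNull}_B(X+Y).$$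 -/

import Mathlib

open CategoryTheory CategoryTheory.Limits

universe w v u

/-! # Categories with families -/

/-- A category with families over `C` (the terminal object of `C` is a separate assumption).
`Tm Γ` is the disjoint union, over all types `X` in context `Γ`, of the sets of elements of `X`, and
`tp` returns the type of an element.  So `Ty` and the sets `Elem X` below form a presheaf on `C` and
a presheaf on its category of elements, and `ext X` with `disp X`, `var X` represents
`(σ : Δ ⟶ Γ) ↦ {elements of X[σ]}`. -/
structure CwF (C : Type u) [Category.{v} C] where
  Ty : C → Type w
  Tm : C → Type w
  tp : ∀ {Γ : C}, Tm Γ → Ty Γ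
  /-- reindexing of types -/
  sub : ∀ {Δ Γ : C}, (Δ ⟶ Γ) → Ty Γ → Ty Δ
  sub_id : ∀ {Γ : C} (X : Ty Γ), sub (𝟙 Γ) X = X
  sub_comp : ∀ {Θ Δ Γ : C} (τ : Θ ⟶ Δ) (σ : Δ ⟶ Γ) (X : Ty Γ), sub (τ ≫ σ) X = sub τ (sub σ X)
  /-- reindexing of elements -/
  subTm : ∀ {Δ Γ : C}, (Δ ⟶ Γ) → Tm Γ → Tm Δ
  subTm_id : ∀ {Γ : C} (a : Tm Γ), subTm (𝟙 Γ) a = a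
  subTm_comp : ∀ {Θ Δ Γ : C} (τ : Θ ⟶ Δ) (σ : Δ ⟶ Γ) (a : Tm Γ),
    subTm (τ ≫ σ) a = subTm τ (subTm σ a)
  tp_subTm : ∀ {Δ Γ : C} (σ : Δ ⟶ Γ) (a : Tm Γ), tp (subTm σ a) = sub σ (tp a)
  /-- context extension `Γ.X` with its projection and its generic element -/
  ext : ∀ {Γ : C}, Ty Γ → C
  disp : ∀ {Γ : C} (X : Ty Γ), ext X ⟶ Γ
  var : ∀ {Γ : C} (X : Ty Γ), Tm (ext X)
  tp_var : ∀ {Γ : C} (X : Ty Γ), tp (var X) = sub (disp X) X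
  pair : ∀ {Δ Γ : C} {X : Ty Γ} (σ : Δ ⟶ Γ) (a : Tm Δ), tp a = sub σ X → (Δ ⟶ ext X)
  pair_disp : ∀ {Δ Γ : C} {X : Ty Γ} (σ : Δ ⟶ Γ) (a : Tm Δ) (h : tp a = sub σ X),
    pair σ a h ≫ disp X = σ
  pair_var : ∀ {Δ Γ : C} {X : Ty Γ} (σ : Δ ⟶ Γ) (a : Tm Δ) (h : tp a = sub σ X),
    subTm (pair σ a h) (var X) = a
  ext_hom : ∀ {Δ Γ : C} {X : Ty Γ} (τ τ' : Δ ⟶ ext X),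
    τ ≫ disp X = τ' ≫ disp X → subTm τ (var X) = subTm τ' (var X) → τ = τ'

namespace CwF

section Basic

variable {C : Type u} [Category.{v} C] (E : CwF.{w, v, u} C)

/-- The elements of type `X`. -/
def Elem {Γ : C} (X : E.Ty Γ) : Type w := {a : E.Tm Γ // E.tp a = X}

variable {E}

/-- An element of `X`, seen as an element of the equal type `X'`. -/
def Elem.cast {Γ : C} {X X' : E.Ty Γ} (a : E.Elem X) (h : X = X') : E.Elem X' :=
  ⟨a.1, a.2.trans h⟩

/-- `a[σ]` -/
def Elem.sub {Δ Γ : C} {X : E.Ty Γ} (a : E.Elem X) (σ : Δ ⟶ Γ) : E.Elem (E.sub σ X) :=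
  ⟨E.subTm σ a.1, by rw [E.tp_subTm, a.2]⟩

variable (E)

/-- The generic element of `X` in context `Γ.X`. -/
def gen {Γ : C} (X : E.Ty Γ) : E.Elem (E.sub (E.disp X) X) := ⟨E.var X, E.tp_var X⟩

/-- `⟨σ, a⟩ : Δ ⟶ Γ.X` -/
def into {Δ Γ : C} (X : E.Ty Γ) (σ : Δ ⟶ Γ) (a : E.Elem (E.sub σ X)) : Δ ⟶ E.ext X :=
  E.pair σ a.1 a.2

theorem into_disp {Δ Γ : C} (X : E.Ty Γ) (σ : Δ ⟶ Γ) (a : E.Elem (E.sub σ X)) :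
    E.into X σ a ≫ E.disp X = σ := E.pair_disp _ _ _

theorem into_var {Δ Γ : C} (X : E.Ty Γ) (σ : Δ ⟶ Γ) (a : E.Elem (E.sub σ X)) :
    E.subTm (E.into X σ a) (E.var X) = a.1 := E.pair_var _ _ _

/-- The section `Γ ⟶ Γ.X` given by an element of `X`. -/
def sec {Γ : C} {X : E.Ty Γ} (a : E.Elem X) : Γ ⟶ E.ext X :=
  E.into X (𝟙 Γ) (a.cast (E.sub_id X).symm)

theorem sec_disp {Γ : C} {X : E.Ty Γ} (a : E.Elem X) : E.sec a ≫ E.disp X = 𝟙 Γ :=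
  E.into_disp _ _ _

theorem sec_var {Γ : C} {X : E.Ty Γ} (a : E.Elem X) : E.subTm (E.sec a) (E.var X) = a.1 :=
  E.into_var _ _ _

/-- The map `Δ.X' ⟶ Γ.X` over `σ : Δ ⟶ Γ`, where `X' = X[σ]`. -/
def liftEq {Δ Γ : C} (σ : Δ ⟶ Γ) {X' : E.Ty Δ} {X : E.Ty Γ} (h : X' = E.sub σ X) :
    E.ext X' ⟶ E.ext X :=
  E.into X (E.disp X' ≫ σ) ((E.gen X').cast (by rw [E.sub_comp, h]))

theorem liftEq_disp {Δ Γ : C} (σ : Δ ⟶ Γ) {X' : E.Ty Δ} {X : E.Ty Γ} (h : X' = E.sub σ X) :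
    E.liftEq σ h ≫ E.disp X = E.disp X' ≫ σ := E.into_disp _ _ _

theorem liftEq_var {Δ Γ : C} (σ : Δ ⟶ Γ) {X' : E.Ty Δ} {X : E.Ty Γ} (h : X' = E.sub σ X) :
    E.subTm (E.liftEq σ h) (E.var X) = E.var X' := E.into_var _ _ _

/-- The map `Δ.X[σ] ⟶ Γ.X` over `σ : Δ ⟶ Γ`. -/
abbrev lift {Δ Γ : C} (σ : Δ ⟶ Γ) (X : E.Ty Γ) : E.ext (E.sub σ X) ⟶ E.ext X :=
  E.liftEq σ rfl

theorem liftEq_comp {Θ Δ Γ : C} (τ : Θ ⟶ Δ) (σ : Δ ⟶ Γ) {X'' : E.Ty Θ} {X' : E.Ty Δ} {X : E.Ty Γ}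
    (h' : X'' = E.sub τ X') (h : X' = E.sub σ X) (h'' : X'' = E.sub (τ ≫ σ) X) :
    E.liftEq τ h' ≫ E.liftEq σ h = E.liftEq (τ ≫ σ) h'' := by
  apply E.ext_hom
  · rw [Category.assoc, liftEq_disp, ← Category.assoc, liftEq_disp, liftEq_disp, Category.assoc]
  · rw [E.subTm_comp, liftEq_var, liftEq_var, liftEq_var]

theorem liftEq_id {Γ : C} {X : E.Ty Γ} (h : X = E.sub (𝟙 Γ) X) :
    E.liftEq (𝟙 Γ) h = 𝟙 (E.ext X) := by
  apply E.ext_hom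
  · rw [liftEq_disp, Category.comp_id, Category.id_comp]
  · rw [liftEq_var, E.subTm_id]

theorem sec_comp_lift {Δ Γ : C} (σ : Δ ⟶ Γ) {X' : E.Ty Δ} {X : E.Ty Γ} (h : X' = E.sub σ X)
    (a' : E.Elem X') (a : E.Elem X) (ha : a'.1 = E.subTm σ a.1) :
    E.sec a' ≫ E.liftEq σ h = σ ≫ E.sec a := by
  apply E.ext_hom
  · rw [Category.assoc, liftEq_disp, ← Category.assoc, sec_disp, Category.assoc, sec_disp,
      Category.id_comp, Category.comp_id]
  · rw [E.subTm_comp, liftEq_var, sec_var, E.subTm_comp, sec_var, ha]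

theorem sub_disp_lift {Δ Γ : C} (σ : Δ ⟶ Γ) (X Y : E.Ty Γ) :
    E.sub (E.lift σ X) (E.sub (E.disp X) Y) = E.sub (E.disp (E.sub σ X)) (E.sub σ Y) := by
  rw [← E.sub_comp, liftEq_disp, E.sub_comp]

theorem sub_sec_disp {Γ : C} {X : E.Ty Γ} (a : E.Elem X) (Y : E.Ty Γ) :
    E.sub (E.sec a) (E.sub (E.disp X) Y) = Y := by
  rw [← E.sub_comp, sec_disp, E.sub_id]

theorem sub_sec {Δ Γ : C} (σ : Δ ⟶ Γ) {X : E.Ty Γ} (a : E.Elem X) (Y : E.Ty (E.ext X)) :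
    E.sub σ (E.sub (E.sec a) Y) = E.sub (E.sec (a.sub σ)) (E.sub (E.lift σ X) Y) := by
  rw [← E.sub_comp, ← E.sub_comp, E.sec_comp_lift σ rfl (a.sub σ) a rfl]

/-- The map `Γ.X ⟶ Γ.Y` over `Γ` given by `x : X ⊢ F x : Y`. -/
def mor {Γ : C} {X Y : E.Ty Γ} (F : E.Elem (E.sub (E.disp X) Y)) : E.ext X ⟶ E.ext Y :=
  E.into Y (E.disp X) F

/-- In extensional type theory, `Γ ⊢ X` is a mere proposition (any two of its elements, in any
context over `Γ`, are equal) iff the projection `Γ.X ⟶ Γ` is a monomorphism. -/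
def MereProp {Γ : C} (X : E.Ty Γ) : Prop := Mono (E.disp X)

section Closed

variable [HasTerminal C]

/-- A closed type, weakened to the context `Γ`. -/
noncomputable abbrev cst (Γ : C) (X : E.Ty (⊤_ C)) : E.Ty Γ := E.sub (terminal.from Γ) X

theorem sub_cst {Δ Γ : C} (σ : Δ ⟶ Γ) (X : E.Ty (⊤_ C)) :
    E.sub σ (E.cst Γ X) = E.cst Δ X := by
  rw [← E.sub_comp, Subsingleton.elim (σ ≫ terminal.from Γ) (terminal.from Δ)]

/-- A closed element, weakened to the context `Γ`. -/
noncomputable def cstEl (Γ : C) {X : E.Ty (⊤_ C)} (a : E.Elem X) : E.Elem (E.cst Γ X) :=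
  a.sub (terminal.from Γ)

theorem subTm_cstEl {Δ Γ : C} (σ : Δ ⟶ Γ) {X : E.Ty (⊤_ C)} (a : E.Elem X) :
    E.subTm σ (E.cstEl Γ a).1 = (E.cstEl Δ a).1 := by
  change E.subTm σ (E.subTm _ a.1) = E.subTm _ a.1
  rw [← E.subTm_comp, Subsingleton.elim (σ ≫ terminal.from Γ) (terminal.from Δ)]

/-- The generic element of a closed type, in the extended context. -/
noncomputable def genCst (Γ : C) (X : E.Ty (⊤_ C)) : E.Elem (E.cst (E.ext (E.cst Γ X)) X) :=
  (E.gen (E.cst Γ X)).cast (E.sub_cst _ X)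

/-- Every context is isomorphic to `1.X` for some closed type `X`. -/
def Democratic : Prop := ∀ Γ : C, ∃ X : E.Ty (⊤_ C), Nonempty (Γ ≅ E.ext X)

/-- The functor `Γ ↦ Γ.X = Γ × X` for a closed type `X`. -/
noncomputable def times (X : E.Ty (⊤_ C)) : C ⥤ C where
  obj Γ := E.ext (E.cst Γ X)
  map σ := E.liftEq σ (E.sub_cst σ X).symm
  map_id _ := E.liftEq_id _
  map_comp τ σ := (E.liftEq_comp τ σ _ _ _).symm

end Closed

end Basic

/-! # Type formers of extensional type theory -/

/-- Dependent products, dependent sums, extensional identity types, unit type, finite colimits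
(empty type, binary sums, coequalisers), natural numbers and propositional truncation.
All operations are stable under reindexing.  Eliminators are given by universal properties; they are
stable under reindexing by uniqueness. -/
structure TypeFormers {C : Type u} [Category.{v} C] [HasTerminal C] (E : CwF.{w, v, u} C) where
  -- dependent products
  Pi : ∀ {Γ : C} (X : E.Ty Γ), E.Ty (E.ext X) → E.Ty Γ
  Pi_sub : ∀ {Δ Γ : C} (σ : Δ ⟶ Γ) (X : E.Ty Γ) (Y : E.Ty (E.ext X)),
    E.sub σ (Pi X Y) = Pi (E.sub σ X) (E.sub (E.lift σ X) Y)
  lam : ∀ {Γ : C} (X : E.Ty Γ) {Y : E.Ty (E.ext X)}, E.Elem Y → E.Elem (Pi X Y)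
  lam_sub : ∀ {Δ Γ : C} (σ : Δ ⟶ Γ) (X : E.Ty Γ) {Y : E.Ty (E.ext X)} (b : E.Elem Y),
    E.subTm σ (lam X b).1 = (lam (E.sub σ X) (b.sub (E.lift σ X))).1
  lam_bijective : ∀ {Γ : C} (X : E.Ty Γ) (Y : E.Ty (E.ext X)),
    Function.Bijective (fun b : E.Elem Y => lam X b)
  -- dependent sums
  Sig : ∀ {Γ : C} (X : E.Ty Γ), E.Ty (E.ext X) → E.Ty Γ
  Sig_sub : ∀ {Δ Γ : C} (σ : Δ ⟶ Γ) (X : E.Ty Γ) (Y : E.Ty (E.ext X)),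
    E.sub σ (Sig X Y) = Sig (E.sub σ X) (E.sub (E.lift σ X) Y)
  sig : ∀ {Γ : C} {X : E.Ty Γ} (Y : E.Ty (E.ext X)) (a : E.Elem X),
    E.Elem (E.sub (E.sec a) Y) → E.Elem (Sig X Y)
  sig_sub : ∀ {Δ Γ : C} (σ : Δ ⟶ Γ) {X : E.Ty Γ} (Y : E.Ty (E.ext X)) (a : E.Elem X)
    (b : E.Elem (E.sub (E.sec a) Y)),
    E.subTm σ (sig Y a b).1 =
      (sig (E.sub (E.lift σ X) Y) (a.sub σ) ((b.sub σ).cast (E.sub_sec σ a Y))).1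
  sig_bijective : ∀ {Γ : C} (X : E.Ty Γ) (Y : E.Ty (E.ext X)),
    Function.Bijective (fun ab : (Σ a : E.Elem X, E.Elem (E.sub (E.sec a) Y)) => sig Y ab.1 ab.2)
  -- extensional identity types
  EqTy : ∀ {Γ : C} {X : E.Ty Γ}, E.Elem X → E.Elem X → E.Ty Γ
  EqTy_sub : ∀ {Δ Γ : C} (σ : Δ ⟶ Γ) {X : E.Ty Γ} (a b : E.Elem X),
    E.sub σ (EqTy a b) = EqTy (a.sub σ) (b.sub σ)
  EqTy_inhabited : ∀ {Γ : C} {X : E.Ty Γ} (a b : E.Elem X), Nonempty (E.Elem (EqTy a b)) ↔ a = b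
  EqTy_subsingleton : ∀ {Γ : C} {X : E.Ty Γ} (a b : E.Elem X), Subsingleton (E.Elem (EqTy a b))
  -- unit type
  one : E.Ty (⊤_ C)
  one_elim : ∀ Γ : C, Nonempty (Unique (E.Elem (E.cst Γ one)))
  -- empty type
  bot : E.Ty (⊤_ C)
  bot_elim : ∀ {Γ : C} (Z : E.Ty (E.ext (E.cst Γ bot))), Nonempty (Unique (E.Elem Z))
  -- binary sums
  SumTy : ∀ {Γ : C}, E.Ty Γ → E.Ty Γ → E.Ty Γ
  SumTy_sub : ∀ {Δ Γ : C} (σ : Δ ⟶ Γ) (X Y : E.Ty Γ),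
    E.sub σ (SumTy X Y) = SumTy (E.sub σ X) (E.sub σ Y)
  inl : ∀ {Γ : C} (X Y : E.Ty Γ), E.Elem (E.sub (E.disp X) (SumTy X Y))
  inl_sub : ∀ {Δ Γ : C} (σ : Δ ⟶ Γ) (X Y : E.Ty Γ),
    E.subTm (E.lift σ X) (inl X Y).1 = (inl (E.sub σ X) (E.sub σ Y)).1
  inr : ∀ {Γ : C} (X Y : E.Ty Γ), E.Elem (E.sub (E.disp Y) (SumTy X Y))
  inr_sub : ∀ {Δ Γ : C} (σ : Δ ⟶ Γ) (X Y : E.Ty Γ),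
    E.subTm (E.lift σ Y) (inr X Y).1 = (inr (E.sub σ X) (E.sub σ Y)).1
  SumTy_elim : ∀ {Γ : C} (X Y : E.Ty Γ) (Z : E.Ty (E.ext (SumTy X Y))),
    Function.Bijective (fun t : E.Elem Z => (t.sub (E.mor (inl X Y)), t.sub (E.mor (inr X Y))))
  -- coequalisers
  Coeq : ∀ {Γ : C} {X Y : E.Ty Γ} (_ _ : E.Elem (E.sub (E.disp X) Y)), E.Ty Γ
  Coeq_sub : ∀ {Δ Γ : C} (σ : Δ ⟶ Γ) {X Y : E.Ty Γ} (F G : E.Elem (E.sub (E.disp X) Y)),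
    E.sub σ (Coeq F G) =
      Coeq ((F.sub (E.lift σ X)).cast (E.sub_disp_lift σ X Y))
        ((G.sub (E.lift σ X)).cast (E.sub_disp_lift σ X Y))
  quo : ∀ {Γ : C} {X Y : E.Ty Γ} (F G : E.Elem (E.sub (E.disp X) Y)),
    E.Elem (E.sub (E.disp Y) (Coeq F G))
  quo_sub : ∀ {Δ Γ : C} (σ : Δ ⟶ Γ) {X Y : E.Ty Γ} (F G : E.Elem (E.sub (E.disp X) Y)),
    E.subTm (E.lift σ Y) (quo F G).1 =
      (quo ((F.sub (E.lift σ X)).cast (E.sub_disp_lift σ X Y))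
        ((G.sub (E.lift σ X)).cast (E.sub_disp_lift σ X Y))).1
  quo_eq : ∀ {Γ : C} {X Y : E.Ty Γ} (F G : E.Elem (E.sub (E.disp X) Y)),
    E.mor F ≫ E.mor (quo F G) = E.mor G ≫ E.mor (quo F G)
  Coeq_elim : ∀ {Γ : C} {X Y : E.Ty Γ} (F G : E.Elem (E.sub (E.disp X) Y))
    (Z : E.Ty (E.ext (Coeq F G))) (z : E.Elem (E.sub (E.mor (quo F G)) Z)),
    E.subTm (E.mor F) z.1 = E.subTm (E.mor G) z.1 → ∃! t : E.Elem Z, t.sub (E.mor (quo F G)) = z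
  -- natural numbers
  nat : E.Ty (⊤_ C)
  zero : E.Elem nat
  succ : E.Elem (E.cst (E.ext nat) nat)
  nat_elim : ∀ {Γ : C} (Z : E.Ty (E.ext (E.cst Γ nat)))
    (z : E.Elem (E.sub (E.sec (E.cstEl Γ zero)) Z))
    (s : E.Elem (E.sub (E.disp Z ≫ E.mor
      ((succ.sub (E.lift (terminal.from Γ) nat)).cast
        ((E.sub_cst _ nat).trans (E.sub_cst _ nat).symm))) Z)),
    ∃! t : E.Elem Z,
      t.sub (E.sec (E.cstEl Γ zero)) = z ∧
      E.subTm (E.mor ((succ.sub (E.lift (terminal.from Γ) nat)).cast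
        ((E.sub_cst _ nat).trans (E.sub_cst _ nat).symm))) t.1 = E.subTm (E.sec t) s.1
  -- propositional truncation
  Tr : ∀ {Γ : C}, E.Ty Γ → E.Ty Γ
  Tr_sub : ∀ {Δ Γ : C} (σ : Δ ⟶ Γ) (X : E.Ty Γ), E.sub σ (Tr X) = Tr (E.sub σ X)
  Tr_mereProp : ∀ {Γ : C} (X : E.Ty Γ), E.MereProp (Tr X)
  tr : ∀ {Γ : C} (X : E.Ty Γ), E.Elem (E.sub (E.disp X) (Tr X))
  Tr_elim : ∀ {Γ : C} (X : E.Ty Γ) (Z : E.Ty (E.ext (Tr X))), E.MereProp Z →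
    Nonempty (E.Elem (E.sub (E.mor (tr X)) Z)) → Nonempty (E.Elem Z)

namespace TypeFormers

section Derived

variable {C : Type u} [Category.{v} C] [HasTerminal C] {E : CwF.{w, v, u} C} (T : TypeFormers E)

/-- The function type `X → Y`. -/
def Arrow {Γ : C} (X Y : E.Ty Γ) : E.Ty Γ := T.Pi X (E.sub (E.disp X) Y)

theorem Arrow_sub {Δ Γ : C} (σ : Δ ⟶ Γ) (X Y : E.Ty Γ) :
    E.sub σ (T.Arrow X Y) = T.Arrow (E.sub σ X) (E.sub σ Y) := by
  rw [Arrow, T.Pi_sub, E.sub_disp_lift, Arrow]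

/-- The product type `X × Y`. -/
def ProdTy {Γ : C} (X Y : E.Ty Γ) : E.Ty Γ := T.Sig X (E.sub (E.disp X) Y)

/-- The disjunction `X ∨ Y`. -/
def OrTy {Γ : C} (X Y : E.Ty Γ) : E.Ty Γ := T.Tr (T.SumTy X Y)

/-- The negation `¬ X`. -/
noncomputable def NotTy {Γ : C} (X : E.Ty Γ) : E.Ty Γ := T.Arrow X (E.cst Γ T.bot)

/-- `X` and `Y` are logically equivalent. -/
def LogEquiv {Γ : C} (X Y : E.Ty Γ) : Prop :=
  Nonempty (E.Elem (T.Arrow X Y)) ∧ Nonempty (E.Elem (T.Arrow Y X))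

/-- The inverse of `lam`. -/
noncomputable def unlam {Γ : C} (X : E.Ty Γ) {Y : E.Ty (E.ext X)} (f : E.Elem (T.Pi X Y)) :
    E.Elem Y :=
  (Equiv.ofBijective _ (T.lam_bijective X Y)).symm f

/-- Application of `f : X → Y` to `a : X`. -/
noncomputable def app {Γ : C} {X Y : E.Ty Γ} (f : E.Elem (T.Arrow X Y)) (a : E.Elem X) :
    E.Elem Y :=
  ((T.unlam X f).sub (E.sec a)).cast (E.sub_sec_disp a Y)

/-- The family of constant functions, `x : X ⊢ λ b. x : B → X`. -/
def constFun {Γ : C} (B X : E.Ty Γ) : E.Elem (E.sub (E.disp X) (T.Arrow B X)) :=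
  (T.lam (E.sub (E.disp X) B) ((E.gen X).sub (E.disp (E.sub (E.disp X) B)))).cast
    (T.Arrow_sub (E.disp X) B X).symm

end Derived

end TypeFormers

/-! # Interval and cofibrant propositions -/

/-- The interval and the cofibrant propositions of an Orton--Pitts model: `ax1`--`ax8` of Orton and
Pitts, propositional extensionality, and a right adjoint to exponentiation by the interval.
(The remaining data of such a model, namely universes with the strictness axiom `ax9` and cofibrant
`W`-types with reductions, do not occur in the statement and are not required.) -/
structure OrtonPitts {C : Type u} [Category.{v} C] [HasTerminal C] {E : CwF.{w, v, u} C}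
    (T : TypeFormers E) where
  I : E.Ty (⊤_ C)
  i0 : E.Elem I
  i1 : E.Elem I
  meet : ∀ {Γ : C}, E.Elem (E.cst Γ I) → E.Elem (E.cst Γ I) → E.Elem (E.cst Γ I)
  meet_sub : ∀ {Δ Γ : C} (σ : Δ ⟶ Γ) (i j : E.Elem (E.cst Γ I)),
    (meet i j).sub σ = (meet ((i.sub σ).cast (E.sub_cst σ I)) ((j.sub σ).cast (E.sub_cst σ I))).cast
      (E.sub_cst σ I).symm
  join : ∀ {Γ : C}, E.Elem (E.cst Γ I) → E.Elem (E.cst Γ I) → E.Elem (E.cst Γ I)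
  join_sub : ∀ {Δ Γ : C} (σ : Δ ⟶ Γ) (i j : E.Elem (E.cst Γ I)),
    (join i j).sub σ = (join ((i.sub σ).cast (E.sub_cst σ I)) ((j.sub σ).cast (E.sub_cst σ I))).cast
      (E.sub_cst σ I).symm
  /-- The type of cofibrant propositions; `φ : Γ ⟶ 1.Cof` is an element of it in context `Γ`. -/
  Cof : E.Ty (⊤_ C)
  /-- The type `φ : Cof ⊢ [φ]`. -/
  Holds : E.Ty (E.ext Cof)
  Holds_mereProp : E.MereProp Holds
  propExt : ∀ {Γ : C} (φ ψ : Γ ⟶ E.ext Cof),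
    T.LogEquiv (E.sub φ Holds) (E.sub ψ Holds) → φ = ψ
  /-- Every decidable predicate on `I` is either everywhere true or everywhere false. -/
  ax1 : ∀ {Γ : C} (P : E.Ty (E.ext (E.cst Γ I))), E.MereProp P →
    Nonempty (E.Elem (T.Pi (E.cst Γ I) (T.OrTy P (T.NotTy P)))) →
    Nonempty (E.Elem (T.OrTy (T.Pi (E.cst Γ I) P) (T.Pi (E.cst Γ I) (T.NotTy P))))
  ax2 : Nonempty (E.Elem (T.NotTy (T.EqTy i0 i1)))
  ax3 : ∀ {Γ : C} (i : E.Elem (E.cst Γ I)),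
    meet (E.cstEl Γ i0) i = E.cstEl Γ i0 ∧ meet i (E.cstEl Γ i0) = E.cstEl Γ i0 ∧
    meet (E.cstEl Γ i1) i = i ∧ meet i (E.cstEl Γ i1) = i
  ax4 : ∀ {Γ : C} (i : E.Elem (E.cst Γ I)),
    join (E.cstEl Γ i0) i = i ∧ join i (E.cstEl Γ i0) = i ∧
    join (E.cstEl Γ i1) i = E.cstEl Γ i1 ∧ join i (E.cstEl Γ i1) = E.cstEl Γ i1
  /-- `i = 0` and `i = 1` are cofibrant. -/
  ax5 : ∀ {Γ : C} (i : E.Elem (E.cst Γ I)),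
    (∃ χ : Γ ⟶ E.ext Cof, T.LogEquiv (E.sub χ Holds) (T.EqTy i (E.cstEl Γ i0))) ∧
    (∃ χ : Γ ⟶ E.ext Cof, T.LogEquiv (E.sub χ Holds) (T.EqTy i (E.cstEl Γ i1)))
  /-- `φ ∨ ψ` is cofibrant. -/
  ax6 : ∀ {Γ : C} (φ ψ : Γ ⟶ E.ext Cof), ∃ χ : Γ ⟶ E.ext Cof,
    T.LogEquiv (E.sub χ Holds) (T.OrTy (E.sub φ Holds) (E.sub ψ Holds))
  /-- `φ ∧ ψ` is cofibrant, where `ψ` need only be defined and cofibrant when `φ` holds. -/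
  ax7 : ∀ {Γ : C} (φ : Γ ⟶ E.ext Cof) (ψ : E.ext (E.sub φ Holds) ⟶ E.ext Cof),
    ∃ χ : Γ ⟶ E.ext Cof,
      T.LogEquiv (E.sub χ Holds) (T.Sig (E.sub φ Holds) (E.sub ψ Holds))
  /-- `∀ i : I, φ i` is cofibrant. -/
  ax8 : ∀ {Γ : C} (φ : E.ext (E.cst Γ I) ⟶ E.ext Cof), ∃ χ : Γ ⟶ E.ext Cof,
    T.LogEquiv (E.sub χ Holds) (T.Pi (E.cst Γ I) (E.sub φ Holds))
  /-- The exponential functor `(-)^I` (right adjoint to `- × I`) has a right adjoint. -/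
  tiny : ∃ P R : C ⥤ C, Nonempty (E.times I ⊣ P) ∧ Nonempty (P ⊣ R)

namespace OrtonPitts

section Model

variable {C : Type u} [Category.{v} C] [HasTerminal C] {E : CwF.{w, v, u} C} {T : TypeFormers E}
  (M : OrtonPitts T)

/-! ## Fibrations: the types of the univalent model -/

/-- The end points of the interval: `0` for `false`, `1` for `true`. -/
def endpt (e : Bool) : E.Elem M.I := cond e M.i1 M.i0

/-- `Γ.I = Γ × I` -/
noncomputable abbrev cyl (Γ : C) : C := (E.times M.I).obj Γ

noncomputable abbrev cylMap {Δ Γ : C} (σ : Δ ⟶ Γ) : M.cyl Δ ⟶ M.cyl Γ := (E.times M.I).map σ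

/-- The end point inclusion `Γ ⟶ Γ.I`. -/
noncomputable def face (e : Bool) (Γ : C) : Γ ⟶ M.cyl Γ := E.sec (E.cstEl Γ (M.endpt e))

theorem face_cylMap (e : Bool) {Δ Γ : C} (σ : Δ ⟶ Γ) :
    M.face e Δ ≫ M.cylMap σ = σ ≫ M.face e Γ :=
  E.sec_comp_lift σ (E.sub_cst σ M.I).symm _ _ (E.subTm_cstEl σ _).symm

/-- The type `[φ]`. -/
noncomputable abbrev holds {Γ : C} (φ : Γ ⟶ E.ext M.Cof) : E.Ty Γ := E.sub φ M.Holds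

/-- In context `Δ`, an open box in `X` over a path `p` in `Γ`: a cofibrant proposition `φ`, a family
`f : [φ] → Π (i : I), X (p i)` and `a : X (p e)` such that `f u e = a` for `u : [φ]`. -/
structure Box {Γ : C} (X : E.Ty Γ) (e : Bool) (Δ : C) where
  p : M.cyl Δ ⟶ Γ
  φ : Δ ⟶ E.ext M.Cof
  f : E.Elem (E.sub (M.cylMap (E.disp (M.holds φ)) ≫ p) X)
  a : E.Elem (E.sub (M.face e Δ ≫ p) X)
  agree : E.subTm (M.face e (E.ext (M.holds φ))) f.1 = E.subTm (E.disp (M.holds φ)) a.1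

/-- The projection `Δ'.[φ σ] ⟶ Δ.[φ]` over `σ : Δ' ⟶ Δ`. -/
noncomputable def holdsLift {Δ' Δ : C} (σ : Δ' ⟶ Δ) (φ : Δ ⟶ E.ext M.Cof) :
    E.ext (M.holds (σ ≫ φ)) ⟶ E.ext (M.holds φ) :=
  E.liftEq σ (E.sub_comp σ φ M.Holds)

theorem holdsLift_disp {Δ' Δ : C} (σ : Δ' ⟶ Δ) (φ : Δ ⟶ E.ext M.Cof) :
    M.holdsLift σ φ ≫ E.disp (M.holds φ) = E.disp (M.holds (σ ≫ φ)) ≫ σ := E.liftEq_disp _ _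

variable {M} in
/-- Reindexing of open boxes. -/
noncomputable def Box.sub {Γ : C} {X : E.Ty Γ} {e : Bool} {Δ' Δ : C} (b : M.Box X e Δ) (σ : Δ' ⟶ Δ) :
    M.Box X e Δ' where
  p := M.cylMap σ ≫ b.p
  φ := σ ≫ b.φ
  f := (b.f.sub (M.cylMap (M.holdsLift σ b.φ))).cast (by
    rw [← E.sub_comp, ← Category.assoc, ← Category.assoc, ← Functor.map_comp, ← Functor.map_comp,
      holdsLift_disp])
  a := (b.a.sub σ).cast (by
    rw [← E.sub_comp, ← Category.assoc, ← Category.assoc, face_cylMap])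
  agree := by
    change E.subTm _ (E.subTm _ b.f.1) = E.subTm _ (E.subTm _ b.a.1)
    rw [← E.subTm_comp, ← E.subTm_comp, face_cylMap, ← holdsLift_disp, E.subTm_comp, E.subTm_comp,
      b.agree]

/-- A fibration structure: an operation, natural in the context, which sends every open box to an
element of `X` over the opposite end of the path that extends the given partial element. -/
structure Fib {Γ : C} (X : E.Ty Γ) where
  comp : ∀ (e : Bool) {Δ : C} (b : M.Box X e Δ), E.Elem (E.sub (M.face (!e) Δ ≫ b.p) X)
  extends_box : ∀ (e : Bool) {Δ : C} (b : M.Box X e Δ),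
    E.subTm (E.disp (M.holds b.φ)) (comp e b).1 =
      E.subTm (M.face (!e) (E.ext (M.holds b.φ))) b.f.1
  natural : ∀ (e : Bool) {Δ' Δ : C} (σ : Δ' ⟶ Δ) (b : M.Box X e Δ),
    E.subTm σ (comp e b).1 = (comp e (b.sub σ)).1

/-- A type of the univalent model over `Γ`.  Its elements are those of `ty`. -/
structure FibTy (Γ : C) where
  ty : E.Ty Γ
  fib : M.Fib ty

/-! ## Identity types, propositions and equivalences of the univalent model -/

/-- The type `X^I` of functions `I → X`. -/
noncomputable def Paths {Γ : C} (X : E.Ty Γ) : E.Ty Γ := T.Arrow (E.cst Γ M.I) X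

theorem Paths_sub {Δ Γ : C} (σ : Δ ⟶ Γ) (X : E.Ty Γ) :
    E.sub σ (M.Paths X) = M.Paths (E.sub σ X) := by
  rw [Paths, T.Arrow_sub, E.sub_cst, Paths]

/-- `p i` for `p : X^I` and `i : I`. -/
noncomputable def at' {Γ : C} {X : E.Ty Γ} (p : E.Elem (M.Paths X)) (i : E.Elem (E.cst Γ M.I)) :
    E.Elem X :=
  T.app p i

/-- For `p : X^I` and `a : X`, the type of pairs of a cofibrant proposition `φ` and a proof of
`[φ] → Π (i : I), p i = a`. -/
noncomputable def ConstOn {Γ : C} {X : E.Ty Γ} (p : E.Elem (M.Paths X)) (a : E.Elem X) : E.Ty Γ :=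
  T.Sig (E.cst Γ M.Cof)
    (let φ := E.lift (terminal.from Γ) M.Cof
     T.Pi (M.holds φ)
      (let Δ := E.ext (M.holds φ)
       let σ : E.ext (E.cst Δ M.I) ⟶ Γ :=
        E.disp (E.cst Δ M.I) ≫ E.disp (M.holds φ) ≫ E.disp (E.cst Γ M.Cof)
       T.Pi (E.cst Δ M.I)
        (T.EqTy (M.at' ((p.sub σ).cast (M.Paths_sub σ X)) (E.genCst Δ M.I)) (a.sub σ))))

/-- The identity type of the univalent model: `Id a b` consists of a path from `a` to `b` together
with a cofibrant proposition on which the path is constant. -/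
noncomputable def IdTy {Γ : C} {X : E.Ty Γ} (a b : E.Elem X) : E.Ty Γ :=
  T.Sig (M.Paths X)
    (let d := E.disp (M.Paths X)
     let p : E.Elem (M.Paths (E.sub d X)) := (E.gen (M.Paths X)).cast (M.Paths_sub d X)
     T.ProdTy (T.EqTy (M.at' p (E.cstEl _ M.i0)) (a.sub d))
      (T.ProdTy (T.EqTy (M.at' p (E.cstEl _ M.i1)) (b.sub d)) (M.ConstOn p (a.sub d))))

/-- `Π (x y : X), Id x y`. -/
noncomputable def isProp {Γ : C} (X : E.Ty Γ) : E.Ty Γ :=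
  T.Pi X (T.Pi (E.sub (E.disp X) X)
    (M.IdTy ((E.gen X).sub (E.disp (E.sub (E.disp X) X))) (E.gen (E.sub (E.disp X) X))))

/-- `(Σ (g : Y → X), Π (y : Y), Id (F (g y)) y) × (Σ (h : Y → X), Π (x : X), Id (h (F x)) x)`,
for `x : X ⊢ F x : Y`. -/
noncomputable def isEquiv {Γ : C} {X Y : E.Ty Γ} (F : E.Elem (E.sub (E.disp X) Y)) : E.Ty Γ :=
  let G := T.Arrow Y X
  let d := E.disp G
  T.ProdTy
    (T.Sig G (T.Pi (E.sub d Y)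
      (let σ := E.disp (E.sub d Y) ≫ d
       let y : E.Elem (E.sub σ Y) := (E.gen (E.sub d Y)).cast (E.sub_comp _ _ _).symm
       let g : E.Elem (T.Arrow (E.sub σ Y) (E.sub σ X)) :=
        ((E.gen G).sub (E.disp (E.sub d Y))).cast
          ((E.sub_comp _ _ _).symm.trans (T.Arrow_sub σ Y X))
       let Fgy : E.Elem (E.sub σ Y) := (F.sub (E.into X σ (T.app g y))).cast (by
         rw [← E.sub_comp, E.into_disp])
       M.IdTy Fgy y)))
    (T.Sig G (T.Pi (E.sub d X)
      (let σ := E.disp (E.sub d X) ≫ d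
       let x : E.Elem (E.sub σ X) := (E.gen (E.sub d X)).cast (E.sub_comp _ _ _).symm
       let h : E.Elem (T.Arrow (E.sub σ Y) (E.sub σ X)) :=
        ((E.gen G).sub (E.disp (E.sub d X))).cast
          ((E.sub_comp _ _ _).symm.trans (T.Arrow_sub σ Y X))
       let Fx : E.Elem (E.sub σ Y) := (F.sub (E.into X σ x)).cast (by
         rw [← E.sub_comp, E.into_disp])
       M.IdTy (T.app h Fx) x)))

/-! ## Null types -/

/-- For `a : A ⊢ B a`, the type `Π (a : A), isEquiv (λ (x : X). λ (b : B a). x)` over `Γ`. -/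
noncomputable def isNull {A : E.Ty (⊤_ C)} (B : E.Ty (E.ext A)) {Γ : C} (X : E.Ty Γ) : E.Ty Γ :=
  T.Pi (E.cst Γ A)
    (M.isEquiv (T.constFun (E.sub (E.lift (terminal.from Γ) A) B) (E.sub (E.disp (E.cst Γ A)) X)))

/-- A closed type `X` is discrete if `λ x. λ i. x : X → X^I` is an isomorphism. -/
def Discrete (X : E.Ty (⊤_ C)) : Prop :=
  IsIso (E.mor (T.constFun (E.cst (⊤_ C) M.I) X))

end Model

end OrtonPitts

/-- `Γ ⊢ B` is well-supported if its propositional truncation (in the extensional model) is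
inhabited. -/
def TypeFormers.WellSupported {C : Type u} [Category.{v} C] [HasTerminal C] {E : CwF.{w, v, u} C}
    (T : TypeFormers E) {Γ : C} (B : E.Ty Γ) : Prop :=
  Nonempty (E.Elem (T.Tr B))

end CwF

/-!
The null types of a well-supported proposition `B` contain all discrete types and are closed under
binary sums, because a function out of `B` with values in a discrete type is constant.

*Stages.*  An element of `Γ ⊢ X` in a context over `Γ` is a map into the extension `Γ.X`, and
`CwF.Forced G τ` says that the type `Γ ⊢ G` has an element at the stage `τ : Δ ⟶ Γ`.  The universal
properties of the type formers become the clauses of a Kripke–Joyal semantics (`forced_Pi`,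
`forced_Sig`, `forced_eqTy`, `forced_of_Tr`, `forced_of_sum`, …), which turn statements of the
internal language into statements about maps of contexts.  The identity types of the univalent model
become homotopies (`OrtonPitts.Htpy`, `forced_IdTy`), and a type is null if the map `X → (B → X)`
has a left and a right inverse up to homotopy at every stage (`forced_isEquiv_constFun`).

*Discrete types.*  A closed type is discrete iff its paths are constant (`discrete_iff`).  This
condition makes sense in any context (`OrtonPitts.ConstPaths`); for a closed type it yields a
composition operation at once.  Let `X` have constant paths and let `f : B → X`.  Any two elements
of `B` are joined by a path, so `f` takes the same value on both.  There is thus at most one `x`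
with `f b = x` for all `b` provided that `B` is inhabited, and exactly one if an element of `B` is
given; as having exactly one such `x` is a mere proposition in the extensional model, it follows
from the truncation of `B`.  So `X → (B → X)` is an isomorphism of the extensional model
(`ConstPaths.exists_inv_constMap`), and in particular an equivalence.

*Truth values, natural numbers, the empty type.*  The type `2 = 1 + 1` has constant paths, because
the interval is connected and `p i = false` is a decidable predicate of `i` (`constPaths_two`). Sums
are disjoint and extensive: an element of `X + Y` lies in the summand named by its tag in `2`
(`exists_of_tag`), where `false ≠ true` because the end points of the interval differ.  Hence a path
in `X + Y` stays in one summand (`exists_path_inj`), and induction along `ℕ → 1 + ℕ` shows that the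
paths in `ℕ` are constant (`discrete_nat`).  A path in the empty type exists only at inconsistent
stages.

*Sums.*  Let `X` and `Y` be null and let `f : B → X + Y`.  The function `tag ∘ f : B → 2` is
constant as `2` has constant paths, and its value is available without an element of `B`.  After a
case distinction on this value, `f` factors through one summand, where the nullity of that summand
provides the required elements and homotopies (`forced_isEquiv_constFun_sum`).
-/

namespace CwF

/-! ### Elements at a stage, as maps into a context extension -/

section Stages

variable {C : Type u} [Category.{v} C] (E : CwF.{w, v, u} C)

/-- The element of `X[σ]` classified by a map `t : Δ ⟶ Γ.X` over `σ`; inverse to `CwF.into`. -/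
def elt {Δ Γ : C} {X : E.Ty Γ} {σ : Δ ⟶ Γ} (t : Δ ⟶ E.ext X) (h : t ≫ E.disp X = σ) :
    E.Elem (E.sub σ X) :=
  ⟨E.subTm t (E.var X), by rw [E.tp_subTm, E.tp_var, ← E.sub_comp, h]⟩

theorem into_elt {Δ Γ : C} {X : E.Ty Γ} {σ : Δ ⟶ Γ} (t : Δ ⟶ E.ext X) (h : t ≫ E.disp X = σ) :
    E.into X σ (E.elt t h) = t :=
  E.ext_hom _ _ ((E.into_disp _ _ _).trans h.symm) (E.into_var _ _ _)

theorem into_inj {Δ Γ : C} {X : E.Ty Γ} {σ : Δ ⟶ Γ} {a b : E.Elem (E.sub σ X)} :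
    E.into X σ a = E.into X σ b ↔ a = b := by
  refine ⟨fun h => Subtype.ext ?_, fun h => h ▸ rfl⟩
  rw [← E.into_var X σ a, h, E.into_var]

/-- Two maps into the extension `Δ.X[σ]` agree if their images in `Δ` and in `Γ.X` do. -/
theorem pullback_ext {Ξ Δ Γ : C} {σ : Δ ⟶ Γ} {X' : E.Ty Δ} {X : E.Ty Γ} (h : X' = E.sub σ X)
    {t t' : Ξ ⟶ E.ext X'} (h₁ : t ≫ E.disp X' = t' ≫ E.disp X')
    (h₂ : t ≫ E.liftEq σ h = t' ≫ E.liftEq σ h) : t = t' := by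
  apply E.ext_hom _ _ h₁
  rw [← E.liftEq_var σ h, ← E.subTm_comp, h₂, E.subTm_comp]

/-- The map `Ξ ⟶ Δ.X[σ]` with components `ρ : Ξ ⟶ Δ` and `t : Ξ ⟶ Γ.X`. -/
def pull {Ξ Δ Γ : C} {σ : Δ ⟶ Γ} {X' : E.Ty Δ} {X : E.Ty Γ} (h : X' = E.sub σ X)
    (ρ : Ξ ⟶ Δ) (t : Ξ ⟶ E.ext X) (w : t ≫ E.disp X = ρ ≫ σ) : Ξ ⟶ E.ext X' :=
  E.into X' ρ ((E.elt t w).cast (by rw [h, E.sub_comp]))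

theorem pull_disp {Ξ Δ Γ : C} {σ : Δ ⟶ Γ} {X' : E.Ty Δ} {X : E.Ty Γ} (h : X' = E.sub σ X)
    (ρ : Ξ ⟶ Δ) (t : Ξ ⟶ E.ext X) (w : t ≫ E.disp X = ρ ≫ σ) :
    E.pull h ρ t w ≫ E.disp X' = ρ := E.into_disp _ _ _

theorem pull_liftEq {Ξ Δ Γ : C} {σ : Δ ⟶ Γ} {X' : E.Ty Δ} {X : E.Ty Γ} (h : X' = E.sub σ X)
    (ρ : Ξ ⟶ Δ) (t : Ξ ⟶ E.ext X) (w : t ≫ E.disp X = ρ ≫ σ) :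
    E.pull h ρ t w ≫ E.liftEq σ h = t := by
  apply E.ext_hom
  · rw [Category.assoc, liftEq_disp, ← Category.assoc, pull_disp, w]
  · rw [E.subTm_comp, liftEq_var]; exact E.into_var _ _ _

theorem mor_disp {Γ : C} {X Y : E.Ty Γ} (F : E.Elem (E.sub (E.disp X) Y)) :
    E.mor F ≫ E.disp Y = E.disp X := E.into_disp _ _ _

theorem sec_lift {Δ Γ : C} {σ : Δ ⟶ Γ} {X : E.Ty Γ} (a : E.Elem (E.sub σ X)) :
    E.sec a ≫ E.lift σ X = E.into X σ a := by
  apply E.ext_hom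
  · rw [Category.assoc, liftEq_disp, ← Category.assoc, sec_disp, Category.id_comp, into_disp]
  · rw [E.subTm_comp, liftEq_var, sec_var, into_var]

theorem mereProp_iff {Γ : C} (X : E.Ty Γ) :
    E.MereProp X ↔ ∀ ⦃Δ : C⦄ (σ : Δ ⟶ Γ), Subsingleton (E.Elem (E.sub σ X)) := by
  constructor
  · intro h Δ σ
    refine ⟨fun a b => E.into_inj.1 (h.right_cancellation _ _ ?_)⟩
    rw [into_disp, into_disp]
  · refine fun h => ⟨fun t t' e => ?_⟩
    have := h (t' ≫ E.disp X)
    exact (E.into_elt t e).symm.trans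
      ((congrArg _ (Subsingleton.elim _ _)).trans (E.into_elt t' rfl))

theorem MereProp.sub {E : CwF.{w, v, u} C} {Γ : C} {X : E.Ty Γ} (h : E.MereProp X) {Δ : C}
    (σ : Δ ⟶ Γ) : E.MereProp (E.sub σ X) := by
  rw [mereProp_iff] at h ⊢
  intro Ξ τ
  rw [← E.sub_comp]
  exact h _

/-- `G` is inhabited at the stage `τ : Δ ⟶ Γ`: the forcing relation of Kripke--Joyal semantics. -/
def Forced {Γ : C} (G : E.Ty Γ) {Δ : C} (τ : Δ ⟶ Γ) : Prop :=
  ∃ t : Δ ⟶ E.ext G, t ≫ E.disp G = τ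

theorem forced_iff {Γ : C} (G : E.Ty Γ) {Δ : C} (τ : Δ ⟶ Γ) :
    E.Forced G τ ↔ Nonempty (E.Elem (E.sub τ G)) :=
  ⟨fun ⟨t, h⟩ => ⟨E.elt t h⟩, fun ⟨a⟩ => ⟨E.into G τ a, E.into_disp _ _ _⟩⟩

theorem forced_id {Γ : C} (G : E.Ty Γ) : E.Forced G (𝟙 Γ) ↔ Nonempty (E.Elem G) := by
  rw [forced_iff, E.sub_id]

theorem Forced.comp {E : CwF.{w, v, u} C} {Γ : C} {G : E.Ty Γ} {Δ : C} {τ : Δ ⟶ Γ}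
    (h : E.Forced G τ) {Ξ : C} (ρ : Ξ ⟶ Δ) : E.Forced G (ρ ≫ τ) := by
  obtain ⟨t, rfl⟩ := h
  exact ⟨ρ ≫ t, Category.assoc _ _ _⟩

theorem forced_sub {Γ Δ Ξ : C} (G : E.Ty Γ) (σ : Δ ⟶ Γ) (τ : Ξ ⟶ Δ) :
    E.Forced (E.sub σ G) τ ↔ E.Forced G (τ ≫ σ) := by
  rw [forced_iff, forced_iff, E.sub_comp]

end Stages

/-! ### Kripke–Joyal clauses for the type formers -/

namespace TypeFormers

section Forcing

variable {C : Type u} [Category.{v} C] [HasTerminal C] {E : CwF.{w, v, u} C} (T : TypeFormers E)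

theorem nonempty_Pi {Γ : C} (X : E.Ty Γ) (Y : E.Ty (E.ext X)) :
    Nonempty (E.Elem (T.Pi X Y)) ↔ Nonempty (E.Elem Y) :=
  ⟨fun ⟨f⟩ => ⟨T.unlam X f⟩, fun ⟨b⟩ => ⟨T.lam X b⟩⟩

theorem forced_Pi {Γ Δ : C} (X : E.Ty Γ) (Y : E.Ty (E.ext X)) (τ : Δ ⟶ Γ) :
    E.Forced (T.Pi X Y) τ ↔
      ∀ ⦃Ξ : C⦄ (ρ : Ξ ⟶ Δ) (x : Ξ ⟶ E.ext X), x ≫ E.disp X = ρ ≫ τ → E.Forced Y x := by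
  rw [forced_iff, T.Pi_sub, nonempty_Pi, ← forced_iff]
  constructor
  · intro h Ξ ρ x w
    rw [← E.pull_liftEq rfl ρ x w]
    exact h.comp _
  · intro h
    exact h (E.disp _) _ (E.liftEq_disp _ _)

theorem forced_Arrow {Γ Δ : C} (X Y : E.Ty Γ) (τ : Δ ⟶ Γ) :
    E.Forced (T.Arrow X Y) τ ↔
      ∀ ⦃Ξ : C⦄ (ρ : Ξ ⟶ Δ), E.Forced X (ρ ≫ τ) → E.Forced Y (ρ ≫ τ) := by
  rw [Arrow, forced_Pi]
  constructor
  · rintro h Ξ ρ ⟨x, hx⟩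
    rw [← hx]
    exact (E.forced_sub _ _ _).1 (h ρ x hx)
  · intro h Ξ ρ x hx
    rw [forced_sub, hx]
    exact h ρ ⟨x, hx⟩

theorem forced_Sig {Γ Δ : C} (X : E.Ty Γ) (Y : E.Ty (E.ext X)) (τ : Δ ⟶ Γ) :
    E.Forced (T.Sig X Y) τ ↔ ∃ x : Δ ⟶ E.ext X, x ≫ E.disp X = τ ∧ E.Forced Y x := by
  rw [forced_iff, T.Sig_sub]
  constructor
  · rintro ⟨s⟩
    obtain ⟨⟨a, b⟩, -⟩ := (T.sig_bijective _ _).2 s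
    refine ⟨E.into X τ a, E.into_disp _ _ _, ?_⟩
    rw [← sec_lift, ← forced_sub, forced_iff]
    exact ⟨b⟩
  · rintro ⟨x, hx, hY⟩
    rw [← E.into_elt x hx, ← sec_lift, ← forced_sub, forced_iff] at hY
    exact hY.map (T.sig _ _)

theorem forced_ProdTy {Γ Δ : C} (X Y : E.Ty Γ) (τ : Δ ⟶ Γ) :
    E.Forced (T.ProdTy X Y) τ ↔ E.Forced X τ ∧ E.Forced Y τ := by
  rw [ProdTy, forced_Sig]
  constructor
  · rintro ⟨x, hx, hY⟩
    rw [forced_sub, hx] at hY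
    exact ⟨⟨x, hx⟩, hY⟩
  · rintro ⟨⟨x, hx⟩, hY⟩
    exact ⟨x, hx, by rwa [forced_sub, hx]⟩

theorem forced_EqTy {Γ Δ : C} {X : E.Ty Γ} (a b : E.Elem X) (τ : Δ ⟶ Γ) :
    E.Forced (T.EqTy a b) τ ↔ E.subTm τ a.1 = E.subTm τ b.1 := by
  rw [forced_iff, T.EqTy_sub, T.EqTy_inhabited]
  exact Subtype.ext_iff

theorem mereProp_EqTy {Γ : C} {X : E.Ty Γ} (a b : E.Elem X) : E.MereProp (T.EqTy a b) := by
  rw [mereProp_iff]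
  intro Δ σ
  rw [T.EqTy_sub]
  exact T.EqTy_subsingleton _ _

/-- The type of proofs that two maps into `Γ.X`, with the same image in `Γ`, are equal. -/
def eqTy {Δ Γ : C} {X : E.Ty Γ} (u v : Δ ⟶ E.ext X) (h : v ≫ E.disp X = u ≫ E.disp X) : E.Ty Δ :=
  T.EqTy (E.elt u rfl) (E.elt v h)

theorem forced_eqTy {Ξ Δ Γ : C} {X : E.Ty Γ} (u v : Δ ⟶ E.ext X)
    (h : v ≫ E.disp X = u ≫ E.disp X) (τ : Ξ ⟶ Δ) :
    E.Forced (T.eqTy u v h) τ ↔ τ ≫ u = τ ≫ v := by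
  rw [eqTy, forced_EqTy]
  change E.subTm τ (E.subTm u _) = E.subTm τ (E.subTm v _) ↔ _
  rw [← E.subTm_comp, ← E.subTm_comp]
  refine ⟨fun e => E.ext_hom _ _ ?_ e, fun e => by rw [e]⟩
  rw [Category.assoc, Category.assoc, h]

theorem mereProp_eqTy {Δ Γ : C} {X : E.Ty Γ} (u v : Δ ⟶ E.ext X)
    (h : v ≫ E.disp X = u ≫ E.disp X) : E.MereProp (T.eqTy u v h) := T.mereProp_EqTy _ _

/-- Falsity holds at a stage only if every type is inhabited there. -/
theorem forced_of_bot {Δ Ξ : C} {σ : Ξ ⟶ ⊤_ C} (h : E.Forced T.bot σ) (G : E.Ty Δ) (τ : Ξ ⟶ Δ) :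
    E.Forced G τ := by
  obtain ⟨t, ht⟩ := h
  have hw : t ≫ E.disp T.bot = 𝟙 Ξ ≫ terminal.from Ξ := Subsingleton.elim _ _
  obtain ⟨⟨⟨a⟩, -⟩⟩ := T.bot_elim (E.sub (E.disp (E.cst Ξ T.bot) ≫ τ) G)
  have := ((E.forced_iff _ _).2 ⟨a⟩).comp (E.pull rfl (𝟙 Ξ) t hw)
  rwa [← Category.assoc, E.pull_disp, Category.id_comp] at this

theorem eq_of_bot {Γ Ξ : C} {σ : Ξ ⟶ ⊤_ C} (h : E.Forced T.bot σ) {X : E.Ty Γ}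
    {u v : Ξ ⟶ E.ext X} (huv : v ≫ E.disp X = u ≫ E.disp X) : u = v := by
  have := T.forced_of_bot h (T.eqTy u v huv) (𝟙 Ξ)
  rwa [forced_eqTy, Category.id_comp, Category.id_comp] at this

theorem forced_bot_iff {Ξ : C} (σ τ : Ξ ⟶ ⊤_ C) : E.Forced T.bot σ ↔ E.Forced T.bot τ := by
  rw [Subsingleton.elim σ τ]

theorem forced_NotTy {Γ Δ : C} (X : E.Ty Γ) (τ : Δ ⟶ Γ) :
    E.Forced (T.NotTy X) τ ↔ ∀ ⦃Ξ : C⦄ (ρ : Ξ ⟶ Δ),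
      E.Forced X (ρ ≫ τ) → E.Forced T.bot (terminal.from Ξ) := by
  rw [NotTy, forced_Arrow]
  refine forall₃_congr fun Ξ ρ _ => ?_
  rw [forced_sub, forced_bot_iff]

/-- Elimination of the propositional truncation into a mere proposition. -/
theorem forced_of_Tr {Γ : C} {X G : E.Ty Γ} (hX : E.Forced (T.Tr X) (𝟙 Γ)) (hG : E.MereProp G)
    (h : ∀ ⦃Ξ : C⦄ (τ : Ξ ⟶ Γ), E.Forced X τ → E.Forced G τ) : E.Forced G (𝟙 Γ) := by
  obtain ⟨t, ht⟩ := hX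
  have := T.Tr_elim X (E.sub (E.disp (T.Tr X)) G) (hG.sub _) (by
    rw [← forced_iff, forced_sub, mor_disp]
    exact h _ ⟨𝟙 _, Category.id_comp _⟩)
  rw [← forced_iff] at this
  have := this.comp t
  rwa [ht] at this

theorem Tr_intro {Γ Δ : C} {X : E.Ty Γ} {τ : Δ ⟶ Γ} (h : E.Forced X τ) : E.Forced (T.Tr X) τ := by
  obtain ⟨t, rfl⟩ := h
  exact ⟨t ≫ E.mor (T.tr X), by rw [Category.assoc, mor_disp]⟩

/-- The left inclusion `Γ.X ⟶ Γ.(X + Y)`. -/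
def inlMap {Γ : C} (X Y : E.Ty Γ) : E.ext X ⟶ E.ext (T.SumTy X Y) := E.mor (T.inl X Y)

/-- The right inclusion `Γ.Y ⟶ Γ.(X + Y)`. -/
def inrMap {Γ : C} (X Y : E.Ty Γ) : E.ext Y ⟶ E.ext (T.SumTy X Y) := E.mor (T.inr X Y)

theorem inlMap_disp {Γ : C} (X Y : E.Ty Γ) : T.inlMap X Y ≫ E.disp _ = E.disp X := E.mor_disp _

theorem inrMap_disp {Γ : C} (X Y : E.Ty Γ) : T.inrMap X Y ≫ E.disp _ = E.disp Y := E.mor_disp _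

theorem lift_inlMap {Δ Γ : C} (σ : Δ ⟶ Γ) (X Y : E.Ty Γ) :
    T.inlMap (E.sub σ X) (E.sub σ Y) ≫ E.liftEq σ (T.SumTy_sub σ X Y).symm =
      E.lift σ X ≫ T.inlMap X Y := by
  apply E.ext_hom
  · rw [Category.assoc, liftEq_disp, ← Category.assoc, inlMap_disp, Category.assoc, inlMap_disp,
      liftEq_disp]
  · rw [E.subTm_comp, liftEq_var, E.subTm_comp]
    refine (E.into_var _ _ _).trans ?_
    rw [← T.inl_sub]
    exact congrArg _ (E.into_var _ _ _).symm

theorem lift_inrMap {Δ Γ : C} (σ : Δ ⟶ Γ) (X Y : E.Ty Γ) :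
    T.inrMap (E.sub σ X) (E.sub σ Y) ≫ E.liftEq σ (T.SumTy_sub σ X Y).symm =
      E.lift σ Y ≫ T.inrMap X Y := by
  apply E.ext_hom
  · rw [Category.assoc, liftEq_disp, ← Category.assoc, inrMap_disp, Category.assoc, inrMap_disp,
      liftEq_disp]
  · rw [E.subTm_comp, liftEq_var, E.subTm_comp]
    refine (E.into_var _ _ _).trans ?_
    rw [← T.inr_sub]
    exact congrArg _ (E.into_var _ _ _).symm

theorem exists_sum_elim {Γ : C} {X Y : E.Ty Γ} (Z : E.Ty (E.ext (T.SumTy X Y)))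
    (x : E.ext X ⟶ E.ext Z) (hx : x ≫ E.disp Z = T.inlMap X Y)
    (y : E.ext Y ⟶ E.ext Z) (hy : y ≫ E.disp Z = T.inrMap X Y) :
    ∃ t : E.ext (T.SumTy X Y) ⟶ E.ext Z, t ≫ E.disp Z = 𝟙 _ ∧ T.inlMap X Y ≫ t = x ∧
      T.inrMap X Y ≫ t = y := by
  obtain ⟨t, ht⟩ := (T.SumTy_elim X Y Z).2 (E.elt x hx, E.elt y hy)
  obtain ⟨h₁, h₂⟩ := Prod.ext_iff.1 ht
  refine ⟨E.sec t, E.sec_disp _, ?_, ?_⟩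
  · apply E.ext_hom
    · rw [Category.assoc, sec_disp, Category.comp_id, hx]
    · rw [E.subTm_comp, sec_var]; exact congrArg Subtype.val h₁
  · apply E.ext_hom
    · rw [Category.assoc, sec_disp, Category.comp_id, hy]
    · rw [E.subTm_comp, sec_var]; exact congrArg Subtype.val h₂

/-- Non-dependent elimination of sums. -/
theorem exists_sum_desc {Γ : C} {X Y W : E.Ty Γ}
    (x : E.ext X ⟶ E.ext W) (hx : x ≫ E.disp W = E.disp X)
    (y : E.ext Y ⟶ E.ext W) (hy : y ≫ E.disp W = E.disp Y) :
    ∃ t : E.ext (T.SumTy X Y) ⟶ E.ext W, t ≫ E.disp W = E.disp _ ∧ T.inlMap X Y ≫ t = x ∧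
      T.inrMap X Y ≫ t = y := by
  have wx : x ≫ E.disp W = T.inlMap X Y ≫ E.disp _ := by rw [hx, inlMap_disp]
  have wy : y ≫ E.disp W = T.inrMap X Y ≫ E.disp _ := by rw [hy, inrMap_disp]
  obtain ⟨t, h, h₁, h₂⟩ := T.exists_sum_elim (E.sub (E.disp _) W)
    (E.pull rfl (T.inlMap X Y) x wx) (E.pull_disp _ _ _ _)
    (E.pull rfl (T.inrMap X Y) y wy) (E.pull_disp _ _ _ _)
  refine ⟨t ≫ E.lift _ W, ?_, ?_, ?_⟩
  · rw [Category.assoc, liftEq_disp, ← Category.assoc, h, Category.id_comp]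
  · rw [← Category.assoc, h₁, pull_liftEq]
  · rw [← Category.assoc, h₂, pull_liftEq]

/-- Case analysis on an element of a sum at a stage `Ξ`, with the equation it satisfies.  The
motive is the type of functions from `s' = s` to `G`, for `s'` the generic element of the sum. -/
theorem forced_of_sum {Γ Ξ : C} {X Y : E.Ty Γ} (s : Ξ ⟶ E.ext (T.SumTy X Y)) (G : E.Ty Ξ)
    (hX : ∀ ⦃Ξ' : C⦄ (τ : Ξ' ⟶ Ξ) (x : Ξ' ⟶ E.ext X), x ≫ T.inlMap X Y = τ ≫ s → E.Forced G τ)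
    (hY : ∀ ⦃Ξ' : C⦄ (τ : Ξ' ⟶ Ξ) (y : Ξ' ⟶ E.ext Y), y ≫ T.inrMap X Y = τ ≫ s → E.Forced G τ) :
    E.Forced G (𝟙 Ξ) := by
  let σ := s ≫ E.disp _
  let S := T.SumTy (E.sub σ X) (E.sub σ Y)
  have hS : S = E.sub σ (T.SumTy X Y) := (T.SumTy_sub σ X Y).symm
  let s' : Ξ ⟶ E.ext S := E.pull hS (𝟙 Ξ) s (Category.id_comp _).symm
  have hs' : s' ≫ E.disp S = 𝟙 Ξ := E.pull_disp _ _ _ _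
  have hd : (E.disp S ≫ s') ≫ E.disp S = 𝟙 _ ≫ E.disp S := by
    rw [Category.assoc, hs', Category.comp_id, Category.id_comp]
  let Q := T.eqTy (𝟙 (E.ext S)) (E.disp S ≫ s') hd
  let Z : E.Ty (E.ext S) := T.Arrow Q (E.sub (E.disp S) G)
  have h₁ : E.Forced Z (T.inlMap _ _) := by
    rw [forced_Arrow]
    intro Ξ' ρ h
    rw [forced_eqTy, Category.comp_id, Category.assoc, ← Category.assoc _ _ s', inlMap_disp] at h
    rw [forced_sub, Category.assoc, inlMap_disp]
    apply hX _ (ρ ≫ E.lift σ X)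
    rw [Category.assoc, ← lift_inlMap, ← Category.assoc, h]
    simp only [Category.assoc]
    rw [E.pull_liftEq]
  have h₂ : E.Forced Z (T.inrMap _ _) := by
    rw [forced_Arrow]
    intro Ξ' ρ h
    rw [forced_eqTy, Category.comp_id, Category.assoc, ← Category.assoc _ _ s', inrMap_disp] at h
    rw [forced_sub, Category.assoc, inrMap_disp]
    apply hY _ (ρ ≫ E.lift σ Y)
    rw [Category.assoc, ← lift_inrMap, ← Category.assoc, h]
    simp only [Category.assoc]
    rw [E.pull_liftEq]
  obtain ⟨x, hx⟩ := h₁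
  obtain ⟨y, hy⟩ := h₂
  obtain ⟨t, ht, -⟩ := T.exists_sum_elim Z x hx y hy
  have hZ : E.Forced Z (𝟙 _) := ⟨t, ht⟩
  rw [forced_Arrow] at hZ
  have := hZ s' (by
    rw [forced_eqTy, Category.comp_id, Category.comp_id, ← Category.assoc, hs', Category.id_comp])
  rwa [forced_sub, Category.comp_id, hs'] at this

/-- Elimination of a disjunction into a mere proposition. -/
theorem forced_of_Or {Γ : C} {P Q G : E.Ty Γ} (h : E.Forced (T.OrTy P Q) (𝟙 Γ))
    (hG : E.MereProp G) (hP : ∀ ⦃Ξ : C⦄ (τ : Ξ ⟶ Γ), E.Forced P τ → E.Forced G τ)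
    (hQ : ∀ ⦃Ξ : C⦄ (τ : Ξ ⟶ Γ), E.Forced Q τ → E.Forced G τ) : E.Forced G (𝟙 Γ) := by
  refine T.forced_of_Tr h hG ?_
  rintro Ξ τ ⟨s, rfl⟩
  have := T.forced_of_sum s (E.sub (s ≫ E.disp _) G) ?_ ?_
  · rwa [forced_sub, Category.id_comp] at this
  · intro Ξ' τ x hx
    rw [forced_sub, ← Category.assoc, ← hx, Category.assoc, inlMap_disp]
    exact hP _ ⟨x, rfl⟩
  · intro Ξ' τ x hx
    rw [forced_sub, ← Category.assoc, ← hx, Category.assoc, inrMap_disp]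
    exact hQ _ ⟨x, rfl⟩

theorem Or_intro_left {Γ Δ : C} {P Q : E.Ty Γ} {τ : Δ ⟶ Γ} (h : E.Forced P τ) :
    E.Forced (T.OrTy P Q) τ := by
  obtain ⟨t, rfl⟩ := h
  exact T.Tr_intro ⟨t ≫ T.inlMap P Q, by rw [Category.assoc, inlMap_disp]⟩

theorem Or_intro_right {Γ Δ : C} {P Q : E.Ty Γ} {τ : Δ ⟶ Γ} (h : E.Forced Q τ) :
    E.Forced (T.OrTy P Q) τ := by
  obtain ⟨t, rfl⟩ := h
  exact T.Tr_intro ⟨t ≫ T.inrMap P Q, by rw [Category.assoc, inrMap_disp]⟩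

/-- A subtype is a mere proposition if it has at most one element at each stage. -/
theorem mereProp_Sig {Γ : C} {X : E.Ty Γ} {Y : E.Ty (E.ext X)} (hY : E.MereProp Y)
    (h : ∀ ⦃Ξ : C⦄ (x x' : Ξ ⟶ E.ext X), x ≫ E.disp X = x' ≫ E.disp X → E.Forced Y x →
      E.Forced Y x' → x = x') : E.MereProp (T.Sig X Y) := by
  rw [mereProp_iff]
  intro Δ σ
  rw [T.Sig_sub]
  constructor
  intro p q
  obtain ⟨⟨a, b⟩, rfl⟩ := (T.sig_bijective _ _).2 p
  obtain ⟨⟨a', b'⟩, rfl⟩ := (T.sig_bijective _ _).2 q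
  have forced {a : E.Elem (E.sub σ X)} (b : E.Elem (E.sub (E.sec a) (E.sub (E.lift σ X) Y))) :
      E.Forced Y (E.into X σ a) := by
    rw [← sec_lift, ← forced_sub, forced_iff]
    exact ⟨b⟩
  obtain rfl : a = a' :=
    E.into_inj.1 (h _ _ (by rw [into_disp, into_disp]) (forced b) (forced b'))
  have := (E.mereProp_iff _).1 (hY.sub (E.lift σ X)) (E.sec a)
  rw [Subsingleton.elim b b']

end Forcing

end TypeFormers

/-! ### Function types at a stage -/

namespace TypeFormers

section Functions

variable {C : Type u} [Category.{v} C] [HasTerminal C] {E : CwF.{w, v, u} C} (T : TypeFormers E)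

theorem unlam_lam {Γ : C} (X : E.Ty Γ) {Y : E.Ty (E.ext X)} (b : E.Elem Y) :
    T.unlam X (T.lam X b) = b :=
  (Equiv.ofBijective _ (T.lam_bijective X Y)).symm_apply_apply b

theorem lam_unlam {Γ : C} (X : E.Ty Γ) {Y : E.Ty (E.ext X)} (f : E.Elem (T.Pi X Y)) :
    T.lam X (T.unlam X f) = f :=
  (Equiv.ofBijective _ (T.lam_bijective X Y)).apply_symm_apply f

theorem subTm_lam {Δ Γ : C} (σ : Δ ⟶ Γ) {X : E.Ty Γ} {Y : E.Ty (E.ext X)} {X' : E.Ty Δ}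
    {Y' : E.Ty (E.ext X')} (hX : X' = E.sub σ X) (hY : Y' = E.sub (E.liftEq σ hX) Y)
    (b : E.Elem Y) (b' : E.Elem Y') (hb : b'.1 = E.subTm (E.liftEq σ hX) b.1) :
    E.subTm σ (T.lam X b).1 = (T.lam X' b').1 := by
  subst hX hY
  rw [T.lam_sub]
  congr 2
  exact Subtype.ext hb.symm

theorem subTm_unlam {Δ Γ : C} (σ : Δ ⟶ Γ) {X : E.Ty Γ} {Y : E.Ty (E.ext X)} {X' : E.Ty Δ}
    {Y' : E.Ty (E.ext X')} (hX : X' = E.sub σ X) (hY : Y' = E.sub (E.liftEq σ hX) Y)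
    (f : E.Elem (T.Pi X Y)) (f' : E.Elem (T.Pi X' Y')) (hf : f'.1 = E.subTm σ f.1) :
    E.subTm (E.liftEq σ hX) (T.unlam X f).1 = (T.unlam X' f').1 := by
  subst hX hY
  have : T.lam _ ((T.unlam X f).sub (E.lift σ X)) = T.lam _ (T.unlam _ f') := by
    apply Subtype.ext
    rw [lam_unlam, hf, ← T.lam_sub, lam_unlam]
  exact congrArg Subtype.val ((T.lam_bijective _ _).1 this)

theorem subTm_app {Δ Γ : C} (σ : Δ ⟶ Γ) {X Y : E.Ty Γ} {X' Y' : E.Ty Δ} (hX : X' = E.sub σ X)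
    (hY : Y' = E.sub σ Y) (f : E.Elem (T.Arrow X Y)) (a : E.Elem X) (f' : E.Elem (T.Arrow X' Y'))
    (a' : E.Elem X') (hf : f'.1 = E.subTm σ f.1) (ha : a'.1 = E.subTm σ a.1) :
    E.subTm σ (T.app f a).1 = (T.app f' a').1 := by
  change E.subTm σ (E.subTm (E.sec a) (T.unlam X f).1) = E.subTm (E.sec a') (T.unlam X' f').1
  rw [← T.subTm_unlam σ hX (by rw [← E.sub_comp, liftEq_disp, E.sub_comp, hY]) f f' hf,
    ← E.subTm_comp, ← E.subTm_comp, E.sec_comp_lift σ hX a' a ha]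

theorem app_lam {Γ : C} {X Y : E.Ty Γ} (b : E.Elem (E.sub (E.disp X) Y)) (a : E.Elem X) :
    (T.app (X := X) (Y := Y) (T.lam X b) a).1 = E.subTm (E.sec a) b.1 := by
  change E.subTm _ (T.unlam X (T.lam X b)).1 = _
  rw [unlam_lam]

/-- The body of a function is its application, in the extended context, to the generic element. -/
theorem unlam_eq_app {Γ : C} {X Y : E.Ty Γ} (f : E.Elem (T.Arrow X Y)) {X' Y' : E.Ty (E.ext X)}
    (hX : X' = E.sub (E.disp X) X) (hY : Y' = E.sub (E.disp X) Y) (f' : E.Elem (T.Arrow X' Y'))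
    (a' : E.Elem X') (hf : f'.1 = E.subTm (E.disp X) f.1) (ha : a'.1 = E.var X) :
    (T.unlam X f).1 = (T.app f' a').1 := by
  change _ = E.subTm (E.sec a') (T.unlam X' f').1
  rw [← T.subTm_unlam (E.disp X) hX (by rw [← E.sub_comp, liftEq_disp, E.sub_comp, hY]) f f' hf,
    ← E.subTm_comp]
  refine (E.subTm_id _).symm.trans (congrArg (fun t => E.subTm t _) ?_)
  apply E.ext_hom
  · rw [Category.id_comp, Category.assoc, liftEq_disp, ← Category.assoc, sec_disp,
      Category.id_comp]
  · rw [E.subTm_id, E.subTm_comp, liftEq_var, sec_var, ha]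

/-- Application of functions to arguments, both given at the stage `Ξ` as maps into context
extensions with the same image in `Γ`. -/
noncomputable def ap {Ξ Γ : C} {X Y : E.Ty Γ} (f : Ξ ⟶ E.ext (T.Arrow X Y)) (a : Ξ ⟶ E.ext X)
    (h : a ≫ E.disp X = f ≫ E.disp _) : Ξ ⟶ E.ext Y :=
  E.into Y (f ≫ E.disp _) (T.app ((E.elt f rfl).cast (T.Arrow_sub _ X Y)) (E.elt a h))

theorem ap_disp {Ξ Γ : C} {X Y : E.Ty Γ} (f : Ξ ⟶ E.ext (T.Arrow X Y)) (a : Ξ ⟶ E.ext X)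
    (h : a ≫ E.disp X = f ≫ E.disp _) : T.ap f a h ≫ E.disp Y = f ≫ E.disp _ :=
  E.into_disp _ _ _

theorem ap_eq_into {Ξ Γ : C} {X Y : E.Ty Γ} {σ : Ξ ⟶ Γ} (f : Ξ ⟶ E.ext (T.Arrow X Y))
    (a : Ξ ⟶ E.ext X) (hf : f ≫ E.disp _ = σ) (ha : a ≫ E.disp X = σ)
    (f' : E.Elem (T.Arrow (E.sub σ X) (E.sub σ Y))) (hf' : f'.1 = E.subTm f (E.var _)) :
    T.ap f a (ha.trans hf.symm) = E.into Y σ (T.app f' (E.elt a ha)) := by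
  subst hf
  rw [ap]
  congr 2
  exact Subtype.ext hf'.symm

theorem comp_ap {Ξ' Ξ Γ : C} {X Y : E.Ty Γ} (ρ : Ξ' ⟶ Ξ) (f : Ξ ⟶ E.ext (T.Arrow X Y))
    (a : Ξ ⟶ E.ext X) (h : a ≫ E.disp X = f ≫ E.disp _) :
    ρ ≫ T.ap f a h =
      T.ap (ρ ≫ f) (ρ ≫ a) (by rw [Category.assoc, h, Category.assoc]) := by
  apply E.ext_hom
  · rw [Category.assoc, ap_disp, ap_disp, Category.assoc]
  · rw [E.subTm_comp]
    refine (congrArg _ (E.into_var _ _ _)).trans (Eq.trans ?_ (E.into_var _ _ _).symm)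
    exact T.subTm_app ρ (by rw [Category.assoc, E.sub_comp]) (by rw [Category.assoc, E.sub_comp])
      _ _ _ _ (E.subTm_comp _ _ _) (E.subTm_comp _ _ _)

theorem subTm_app_eq_ap {Ξ Δ Γ : C} {X Y : E.Ty Γ} {σ : Δ ⟶ Γ} {X' Y' : E.Ty Δ}
    (hX : X' = E.sub σ X) (hY : Y' = E.sub σ Y) (f : E.Elem (T.Arrow X' Y')) (a : E.Elem X')
    (τ : Ξ ⟶ Δ) (g : Ξ ⟶ E.ext (T.Arrow X Y)) (x : Ξ ⟶ E.ext X) (hg : g ≫ E.disp _ = τ ≫ σ)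
    (hx : x ≫ E.disp X = g ≫ E.disp _) (hfg : E.subTm g (E.var _) = E.subTm τ f.1)
    (hax : E.subTm x (E.var X) = E.subTm τ a.1) :
    E.subTm τ (T.app f a).1 = E.subTm (T.ap g x hx) (E.var Y) := by
  refine Eq.trans ?_ (E.into_var _ _ _).symm
  exact T.subTm_app τ (by rw [hg, hX, E.sub_comp]) (by rw [hg, hY, E.sub_comp]) _ _ _ _ hfg hax

theorem ap_congr {Ξ Γ : C} {X Y : E.Ty Γ} {f f' : Ξ ⟶ E.ext (T.Arrow X Y)} {a a' : Ξ ⟶ E.ext X}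
    (h : a ≫ E.disp X = f ≫ E.disp _) (hf : f = f') (ha : a = a') :
    T.ap f a h = T.ap f' a' (by rw [← hf, ← ha, h]) := by
  subst hf ha; rfl

/-- The function at the stage `σ : Ξ ⟶ Γ` with graph `k : Ξ.X[σ] ⟶ Γ.Y`.  The extension of `Ξ`
is by any type equal to `X[σ]`. -/
def curry {Ξ Γ : C} {X Y : E.Ty Γ} {σ : Ξ ⟶ Γ} {X' : E.Ty Ξ} (h : X' = E.sub σ X)
    (k : E.ext X' ⟶ E.ext Y) (hk : k ≫ E.disp Y = E.disp X' ≫ σ) : Ξ ⟶ E.ext (T.Arrow X Y) :=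
  E.into _ σ ((T.lam X' ((E.elt k hk).cast (E.sub_comp _ _ _))).cast
    (by rw [T.Arrow_sub, h]; rfl))

theorem curry_disp {Ξ Γ : C} {X Y : E.Ty Γ} {σ : Ξ ⟶ Γ} {X' : E.Ty Ξ} (h : X' = E.sub σ X)
    (k : E.ext X' ⟶ E.ext Y) (hk : k ≫ E.disp Y = E.disp X' ≫ σ) :
    T.curry h k hk ≫ E.disp _ = σ := E.into_disp _ _ _

theorem ap_curry {Ξ' Ξ Γ : C} {X Y : E.Ty Γ} {σ : Ξ ⟶ Γ} {X' : E.Ty Ξ} (h : X' = E.sub σ X)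
    (k : E.ext X' ⟶ E.ext Y) (hk : k ≫ E.disp Y = E.disp X' ≫ σ) (ρ : Ξ' ⟶ Ξ)
    (a : Ξ' ⟶ E.ext X) (ha : a ≫ E.disp X = ρ ≫ σ) :
    T.ap (ρ ≫ T.curry h k hk) a (by rw [ha, Category.assoc, curry_disp]) =
      E.pull h ρ a ha ≫ k := by
  have hX : E.sub (ρ ≫ σ) X = E.sub ρ X' := by rw [h, E.sub_comp]
  let b : E.Elem (E.sub (E.disp (E.sub (ρ ≫ σ) X)) (E.sub (ρ ≫ σ) Y)) :=
    ((E.elt k hk).sub (E.liftEq ρ hX)).cast (by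
      rw [← E.sub_comp, ← E.sub_comp, ← Category.assoc, liftEq_disp, Category.assoc])
  rw [T.ap_eq_into _ a (by rw [Category.assoc, curry_disp]) ha (T.lam _ b)]
  · apply E.ext_hom
    · rw [into_disp, Category.assoc, hk, ← Category.assoc, pull_disp]
    · rw [into_var, app_lam]
      change E.subTm _ (E.subTm _ (E.subTm k _)) = _
      rw [← E.subTm_comp, ← E.subTm_comp]
      refine congrArg (fun t => E.subTm (t ≫ k) _) ?_
      apply E.pullback_ext h
      · rw [pull_disp, Category.assoc, liftEq_disp, ← Category.assoc, sec_disp, Category.id_comp]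
      · rw [pull_liftEq, Category.assoc, E.liftEq_comp ρ σ hX h rfl, sec_lift, into_elt]
  · rw [E.subTm_comp]
    refine Eq.trans ?_ (congrArg (E.subTm ρ) (E.into_var _ _ _).symm)
    refine (T.subTm_lam ρ hX ?_ ((E.elt k hk).cast (E.sub_comp _ _ _)) _ rfl).symm
    rw [← E.sub_comp, ← E.sub_comp, ← E.sub_comp, ← Category.assoc, liftEq_disp, Category.assoc]

theorem arrow_ext {Ξ Γ : C} {X Y : E.Ty Γ} {f f' : Ξ ⟶ E.ext (T.Arrow X Y)}
    (h : f ≫ E.disp _ = f' ≫ E.disp _)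
    (H : ∀ ⦃Ξ' : C⦄ (ρ : Ξ' ⟶ Ξ) (a : Ξ' ⟶ E.ext X)
      (ha : a ≫ E.disp X = ρ ≫ f ≫ E.disp _),
      T.ap (ρ ≫ f) a (by rw [ha, Category.assoc]) =
        T.ap (ρ ≫ f') a (by rw [ha, h, Category.assoc])) : f = f' := by
  -- Every map into the extension by a function type is the `curry` of its application to the
  -- generic argument.
  have key (g : Ξ ⟶ E.ext (T.Arrow X Y)) (hg : g ≫ E.disp _ = f ≫ E.disp _) :
      g = T.curry (σ := f ≫ E.disp _) rfl
        (T.ap (E.disp (E.sub (f ≫ E.disp _) X) ≫ g) (E.lift _ X)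
          (by rw [liftEq_disp, Category.assoc, hg]))
        (by rw [ap_disp, Category.assoc, hg]) := by
    apply E.ext_hom
    · rw [curry_disp, hg]
    · refine Eq.trans ?_ (E.into_var _ _ _).symm
      have e : E.sub (f ≫ E.disp _) (T.Arrow X Y) = T.Arrow (E.sub (f ≫ E.disp _) X)
        (E.sub (f ≫ E.disp _) Y) := T.Arrow_sub _ _ _
      set g' := (E.elt g hg).cast e
      change g'.1 = (T.lam _ _).1
      refine (congrArg Subtype.val (T.lam_unlam _ g')).symm.trans
        (congrArg (fun t => (T.lam _ t).1) ?_)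
      apply Subtype.ext
      refine Eq.trans ?_ (E.into_var _ _ _).symm
      refine T.unlam_eq_app g' ?_ ?_ _ _ (E.subTm_comp _ _ _) (E.liftEq_var _ _)
      · rw [Category.assoc, hg, E.sub_comp (E.disp _)]
      · rw [Category.assoc, hg, E.sub_comp (E.disp _)]
  rw [key f rfl, key f' h.symm]
  congr 1
  exact H _ _ (E.liftEq_disp _ _)

/-- The map `Γ.X ⟶ Γ.(B → X)` which sends an element to the constant function. -/
def constMap {Γ : C} (B X : E.Ty Γ) : E.ext X ⟶ E.ext (T.Arrow B X) := E.mor (T.constFun B X)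

theorem constMap_disp {Γ : C} (B X : E.Ty Γ) : T.constMap B X ≫ E.disp _ = E.disp X :=
  E.mor_disp _

theorem ap_constMap {Ξ Γ : C} {B X : E.Ty Γ} (x : Ξ ⟶ E.ext X) (b : Ξ ⟶ E.ext B)
    (h : b ≫ E.disp B = (x ≫ T.constMap B X) ≫ E.disp _) :
    T.ap (x ≫ T.constMap B X) b h = x := by
  have h' : b ≫ E.disp B = x ≫ E.disp X := by rw [h, Category.assoc, constMap_disp]
  exact (T.ap_curry (σ := E.disp X) rfl (E.disp _) rfl x b h').trans (E.pull_disp _ _ _ _)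

/-- Postcomposition with a map `k : Γ.X ⟶ Γ.Y` over `Γ`. -/
noncomputable def post {Γ : C} (B : E.Ty Γ) {X Y : E.Ty Γ} (k : E.ext X ⟶ E.ext Y)
    (hk : k ≫ E.disp Y = E.disp X) : E.ext (T.Arrow B X) ⟶ E.ext (T.Arrow B Y) :=
  T.curry (σ := E.disp (T.Arrow B X)) rfl
    (T.ap (E.disp _) (E.lift _ B) (E.liftEq_disp _ _) ≫ k)
    (by rw [Category.assoc, hk, ap_disp])

theorem post_disp {Γ : C} (B : E.Ty Γ) {X Y : E.Ty Γ} (k : E.ext X ⟶ E.ext Y)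
    (hk : k ≫ E.disp Y = E.disp X) : T.post B k hk ≫ E.disp _ = E.disp _ := T.curry_disp _ _ _

theorem ap_post {Ξ Γ : C} {B X Y : E.Ty Γ} (k : E.ext X ⟶ E.ext Y)
    (hk : k ≫ E.disp Y = E.disp X) (f : Ξ ⟶ E.ext (T.Arrow B X)) (b : Ξ ⟶ E.ext B)
    (h : b ≫ E.disp B = f ≫ E.disp _) :
    T.ap (f ≫ T.post B k hk) b (by rw [h, Category.assoc, post_disp]) = T.ap f b h ≫ k := by
  refine (T.ap_curry (σ := E.disp (T.Arrow B X)) rfl _ _ f b h).trans ?_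
  rw [← Category.assoc, comp_ap]
  congr 1
  exact T.ap_congr _ (E.pull_disp _ _ _ _) (E.pull_liftEq _ _ _ _)

theorem constMap_post {Γ : C} (B : E.Ty Γ) {X Y : E.Ty Γ} (k : E.ext X ⟶ E.ext Y)
    (hk : k ≫ E.disp Y = E.disp X) : T.constMap B X ≫ T.post B k hk = k ≫ T.constMap B Y := by
  apply T.arrow_ext
  · intro Ξ ρ b hb
    have hb' : b ≫ E.disp B = (ρ ≫ T.constMap B X) ≫ E.disp _ := by
      rw [hb]; simp only [Category.assoc, post_disp]
    have hb'' : b ≫ E.disp B = ((ρ ≫ k) ≫ T.constMap B Y) ≫ E.disp _ := by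
      rw [hb']; simp only [Category.assoc, constMap_disp, hk]
    rw [T.ap_congr _ (Category.assoc _ _ _).symm rfl, T.ap_post k hk (ρ ≫ T.constMap B X) b hb',
      ap_constMap, T.ap_congr _ (Category.assoc _ _ _).symm rfl, T.ap_constMap _ _ hb'']
  · rw [Category.assoc, post_disp, constMap_disp, Category.assoc, constMap_disp, hk]

end Functions

end TypeFormers

/-! ### Paths and homotopies -/

namespace OrtonPitts

section Paths

variable {C : Type u} [Category.{v} C] [HasTerminal C] {E : CwF.{w, v, u} C} {T : TypeFormers E}
  (M : OrtonPitts T)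

/-- The projection `Γ × I ⟶ Γ`. -/
noncomputable def proj (Γ : C) : M.cyl Γ ⟶ Γ := E.disp (E.cst Γ M.I)

/-- The map `Ξ × I ⟶ Γ × I` over `σ`, with values in the extension by the weakened interval. -/
noncomputable def coord {Ξ Γ : C} (σ : Ξ ⟶ Γ) : M.cyl Ξ ⟶ E.ext (E.cst Γ M.I) :=
  E.liftEq σ (E.sub_cst σ M.I).symm

/-- The map `Ξ' ⟶ Ξ × I` with the given components. -/
noncomputable def cylPair {Ξ' Ξ Γ : C} {σ : Ξ ⟶ Γ} (ρ : Ξ' ⟶ Ξ) (i : Ξ' ⟶ E.ext (E.cst Γ M.I))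
    (h : i ≫ E.disp _ = ρ ≫ σ) : Ξ' ⟶ M.cyl Ξ :=
  E.pull (E.sub_cst σ M.I).symm ρ i h

theorem cylPair_proj {Ξ' Ξ Γ : C} {σ : Ξ ⟶ Γ} (ρ : Ξ' ⟶ Ξ) (i : Ξ' ⟶ E.ext (E.cst Γ M.I))
    (h : i ≫ E.disp _ = ρ ≫ σ) : M.cylPair ρ i h ≫ M.proj Ξ = ρ := E.pull_disp _ _ _ _

theorem cylPair_coord {Ξ' Ξ Γ : C} {σ : Ξ ⟶ Γ} (ρ : Ξ' ⟶ Ξ) (i : Ξ' ⟶ E.ext (E.cst Γ M.I))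
    (h : i ≫ E.disp _ = ρ ≫ σ) : M.cylPair ρ i h ≫ M.coord σ = i := E.pull_liftEq _ _ _ _

theorem coord_disp {Ξ Γ : C} (σ : Ξ ⟶ Γ) : M.coord σ ≫ E.disp _ = M.proj Ξ ≫ σ :=
  E.liftEq_disp _ _

theorem cyl_ext {Ξ' Ξ Γ : C} (σ : Ξ ⟶ Γ) {t t' : Ξ' ⟶ M.cyl Ξ} (h : t ≫ M.proj Ξ = t' ≫ M.proj Ξ)
    (h' : t ≫ M.coord σ = t' ≫ M.coord σ) : t = t' :=
  E.pullback_ext (E.sub_cst σ M.I).symm h h'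

theorem face_proj (e : Bool) (Γ : C) : M.face e Γ ≫ M.proj Γ = 𝟙 Γ := E.sec_disp _

theorem cylMap_proj {Δ Γ : C} (σ : Δ ⟶ Γ) : M.cylMap σ ≫ M.proj Γ = M.proj Δ ≫ σ :=
  E.liftEq_disp _ (E.sub_cst σ M.I).symm

theorem subTm_coord {Ξ Γ : C} (σ : Ξ ⟶ Γ) :
    E.subTm (M.coord σ) (E.var _) = E.var (E.cst Ξ M.I) := E.liftEq_var _ _

theorem cylMap_coord {Ξ Δ Γ : C} (τ : Ξ ⟶ Δ) (σ : Δ ⟶ Γ) :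
    M.cylMap τ ≫ M.coord σ = M.coord (τ ≫ σ) :=
  E.liftEq_comp _ _ (E.sub_cst τ M.I).symm (E.sub_cst σ M.I).symm _

theorem subTm_face (e : Bool) {Ξ Γ : C} (σ : Ξ ⟶ Γ) :
    E.subTm (M.face e Ξ ≫ M.coord σ) (E.var _) = (E.cstEl Ξ (M.endpt e)).1 := by
  rw [E.subTm_comp]
  exact (congrArg _ (E.liftEq_var _ _)).trans (E.sec_var _)

/-- The map `Ξ × I ⟶ Γ.X` which corresponds to a path in `X` at the stage `Ξ`. -/
noncomputable def pathMap {Ξ Γ : C} {X : E.Ty Γ} (p : Ξ ⟶ E.ext (T.Arrow (E.cst Γ M.I) X)) :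
    M.cyl Ξ ⟶ E.ext X :=
  T.ap (M.proj Ξ ≫ p) (M.coord (p ≫ E.disp _))
    (by rw [coord_disp, Category.assoc])

theorem pathMap_disp {Ξ Γ : C} {X : E.Ty Γ} (p : Ξ ⟶ E.ext (T.Arrow (E.cst Γ M.I) X)) :
    M.pathMap p ≫ E.disp X = M.proj Ξ ≫ p ≫ E.disp _ :=
  (T.ap_disp _ _ _).trans (Category.assoc _ _ _)

theorem comp_pathMap {Ξ' Ξ Γ : C} {X : E.Ty Γ} (p : Ξ ⟶ E.ext (T.Arrow (E.cst Γ M.I) X))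
    (ρ : Ξ' ⟶ M.cyl Ξ) (q : Ξ' ⟶ E.ext (T.Arrow (E.cst Γ M.I) X)) (hq : ρ ≫ M.proj Ξ ≫ p = q)
    (i : Ξ' ⟶ E.ext (E.cst Γ M.I)) (hi : ρ ≫ M.coord (p ≫ E.disp _) = i) :
    ρ ≫ M.pathMap p = T.ap q i (by
      rw [← hq, ← hi]
      simp only [Category.assoc, coord_disp]) := by
  subst hq hi
  exact T.comp_ap _ _ _ _

/-- The path in `X` at the stage `σ : Ξ ⟶ Γ` given by a map `Ξ × I ⟶ Γ.X`. -/
noncomputable def ofPathMap {Ξ Γ : C} {X : E.Ty Γ} {σ : Ξ ⟶ Γ} (k : M.cyl Ξ ⟶ E.ext X)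
    (hk : k ≫ E.disp X = M.proj Ξ ≫ σ) : Ξ ⟶ E.ext (T.Arrow (E.cst Γ M.I) X) :=
  T.curry (E.sub_cst σ M.I).symm k hk

theorem ofPathMap_disp {Ξ Γ : C} {X : E.Ty Γ} {σ : Ξ ⟶ Γ} (k : M.cyl Ξ ⟶ E.ext X)
    (hk : k ≫ E.disp X = M.proj Ξ ≫ σ) : M.ofPathMap k hk ≫ E.disp _ = σ := E.into_disp _ _ _

theorem pathMap_ofPathMap {Ξ Γ : C} {X : E.Ty Γ} {σ : Ξ ⟶ Γ} (k : M.cyl Ξ ⟶ E.ext X)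
    (hk : k ≫ E.disp X = M.proj Ξ ≫ σ) : M.pathMap (M.ofPathMap k hk) = k := by
  refine (T.ap_congr _ rfl (congrArg M.coord (M.ofPathMap_disp k hk))).trans ?_
  refine (T.ap_curry (X := E.cst Γ M.I) (E.sub_cst σ M.I).symm k hk (M.proj Ξ) (M.coord σ)
    (M.coord_disp σ)).trans ?_
  refine Eq.trans ?_ (Category.id_comp k)
  refine congrArg (· ≫ k) ?_
  apply M.cyl_ext σ
  · exact (E.pull_disp _ _ _ _).trans (Category.id_comp _).symm
  · exact (E.pull_liftEq _ _ _ _).trans (Category.id_comp _).symm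

/-- Two maps `u v : Ξ ⟶ Γ.X` are homotopic over `Γ`: there is a path from `u` to `v`, together with
a cofibrant proposition on which it is constant. -/
def Htpy {Ξ Γ : C} {X : E.Ty Γ} (u v : Ξ ⟶ E.ext X) : Prop :=
  ∃ (p : M.cyl Ξ ⟶ E.ext X) (φ : Ξ ⟶ E.ext M.Cof),
    p ≫ E.disp X = M.proj Ξ ≫ u ≫ E.disp X ∧
    M.face false Ξ ≫ p = u ∧ M.face true Ξ ≫ p = v ∧
    ∀ ⦃Ξ' : C⦄ (ρ : Ξ' ⟶ M.cyl Ξ), E.Forced M.Holds (ρ ≫ M.proj Ξ ≫ φ) →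
      ρ ≫ p = ρ ≫ M.proj Ξ ≫ u

variable {M} in
theorem Htpy.precomp {Ξ' Ξ Γ : C} {X : E.Ty Γ} {u v : Ξ ⟶ E.ext X} (h : M.Htpy u v)
    (ρ : Ξ' ⟶ Ξ) : M.Htpy (ρ ≫ u) (ρ ≫ v) := by
  obtain ⟨p, φ, hp, rfl, rfl, hφ⟩ := h
  refine ⟨M.cylMap ρ ≫ p, ρ ≫ φ, ?_, ?_, ?_, ?_⟩
  · rw [Category.assoc, hp, ← Category.assoc, cylMap_proj]; simp only [Category.assoc]
  · rw [← Category.assoc, face_cylMap, Category.assoc]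
  · rw [← Category.assoc, face_cylMap, Category.assoc]
  · intro Ξ'' τ hτ
    rw [← Category.assoc (M.proj _), ← cylMap_proj] at hτ
    have := hφ (τ ≫ M.cylMap ρ) (by simpa only [Category.assoc] using hτ)
    rw [← Category.assoc (M.proj _), ← cylMap_proj]
    simpa only [Category.assoc] using this

variable {M} in
theorem Htpy.postcomp {Ξ Γ Γ' : C} {X : E.Ty Γ} {X' : E.Ty Γ'} {u v : Ξ ⟶ E.ext X}
    (h : M.Htpy u v) (k : E.ext X ⟶ E.ext X') (β : Γ ⟶ Γ')
    (hk : k ≫ E.disp X' = E.disp X ≫ β) : M.Htpy (u ≫ k) (v ≫ k) := by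
  obtain ⟨p, φ, hp, hu, hv, hφ⟩ := h
  refine ⟨p ≫ k, φ, ?_, ?_, ?_, ?_⟩
  · rw [Category.assoc, hk, ← Category.assoc, hp]; simp only [Category.assoc, hk]
  · rw [← Category.assoc, hu]
  · rw [← Category.assoc, hv]
  · intro Ξ' ρ hρ
    rw [← Category.assoc, hφ ρ hρ]; simp only [Category.assoc]

/-- Homotopies lift along a pullback of contexts. -/
theorem htpy_of_liftEq {Ξ Δ Γ : C} {σ : Δ ⟶ Γ} {X' : E.Ty Δ} {X : E.Ty Γ} (h : X' = E.sub σ X)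
    {u v : Ξ ⟶ E.ext X'} (huv : u ≫ E.disp X' = v ≫ E.disp X')
    (H : M.Htpy (u ≫ E.liftEq σ h) (v ≫ E.liftEq σ h)) : M.Htpy u v := by
  obtain ⟨p, φ, hp, hu, hv, hφ⟩ := H
  have hp' : p ≫ E.disp X = (M.proj Ξ ≫ u ≫ E.disp X') ≫ σ := by
    rw [hp]; simp only [Category.assoc, liftEq_disp]
  refine ⟨E.pull h _ p hp', φ, E.pull_disp _ _ _ _, ?_, ?_, ?_⟩
  · apply E.pullback_ext h
    · rw [Category.assoc, pull_disp, ← Category.assoc, face_proj, Category.id_comp]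
    · rw [Category.assoc, pull_liftEq, hu]
  · apply E.pullback_ext h
    · rw [Category.assoc, pull_disp, ← Category.assoc, face_proj, Category.id_comp, huv]
    · rw [Category.assoc, pull_liftEq, hv]
  · intro Ξ' ρ hρ
    apply E.pullback_ext h
    · simp only [Category.assoc, pull_disp]
    · simp only [Category.assoc, pull_liftEq]
      exact hφ ρ hρ

theorem Htpy.refl {Ξ Γ : C} {X : E.Ty Γ} (u : Ξ ⟶ E.ext X) : M.Htpy u u := by
  -- Any cofibrant proposition will do, such as `0 = 0`.
  obtain ⟨φ, -⟩ := (M.ax5 (E.cstEl Ξ M.i0)).1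
  refine ⟨M.proj Ξ ≫ u, φ, Category.assoc _ _ _, ?_, ?_, fun _ _ _ => rfl⟩
  · rw [← Category.assoc, face_proj, Category.id_comp]
  · rw [← Category.assoc, face_proj, Category.id_comp]

/-- `ConstOn q a` at the stage `τ`, in terms of a map `p` which presents the path `q` there: `p` is
constant with value `a` on some cofibrant proposition. -/
theorem forced_ConstOn {Ξ Δ Γ : C} {X : E.Ty Γ} {σ : Δ ⟶ Γ} (q : E.Elem (M.Paths (E.sub σ X)))
    (a : E.Elem (E.sub σ X)) (τ : Ξ ⟶ Δ) (p : Ξ ⟶ E.ext (T.Arrow (E.cst Γ M.I) X))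
    (hp : p ≫ E.disp _ = τ ≫ σ) (hpq : E.subTm p (E.var _) = E.subTm τ q.1) :
    E.Forced (M.ConstOn q a) τ ↔ ∃ φ : Ξ ⟶ E.ext M.Cof,
      ∀ ⦃Ξ' : C⦄ (ρ : Ξ' ⟶ M.cyl Ξ), E.Forced M.Holds (ρ ≫ M.proj Ξ ≫ φ) →
        ρ ≫ M.pathMap p = ρ ≫ M.proj Ξ ≫ τ ≫ E.into X σ a := by
  -- At a stage `ρ` of `Ξ × I`, the equation of the definition is the one in the conclusion.
  have key {Ξ' : C} (ρ : Ξ' ⟶ M.cyl Ξ) {Δ' : C} (δ : Δ' ⟶ Δ)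
      (i : Ξ' ⟶ E.ext (E.cst Δ' M.I)) (hi : i ≫ E.disp _ ≫ δ = ρ ≫ M.proj Ξ ≫ τ)
      (hi' : E.subTm i (E.var _) = E.subTm (ρ ≫ M.coord (p ≫ E.disp _)) (E.var _)) :
      E.Forced (T.EqTy (M.at' ((q.sub (E.disp (E.cst Δ' M.I) ≫ δ)).cast (M.Paths_sub _ _))
        (E.genCst Δ' M.I)) (a.sub (E.disp (E.cst Δ' M.I) ≫ δ))) i ↔
      ρ ≫ M.pathMap p = ρ ≫ M.proj Ξ ≫ τ ≫ E.into X σ a := by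
    rw [T.forced_EqTy]
    have e := T.subTm_app_eq_ap (σ := (E.disp (E.cst Δ' M.I) ≫ δ) ≫ σ) (X := E.cst Γ M.I) (Y := X)
      (X' := E.cst _ M.I) (Y' := E.sub (E.disp (E.cst Δ' M.I) ≫ δ) (E.sub σ X))
      (E.sub_cst _ _).symm (E.sub_comp _ _ _).symm
      ((q.sub (E.disp (E.cst Δ' M.I) ≫ δ)).cast (M.Paths_sub _ _))
      (E.genCst Δ' M.I) i (ρ ≫ M.proj Ξ ≫ p) (ρ ≫ M.coord (p ≫ E.disp _))
      (by simp only [Category.assoc, hp]; rw [reassoc_of% hi])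
      (by simp only [Category.assoc, coord_disp])
      (by
        change _ = E.subTm i (E.subTm _ q.1)
        rw [← E.subTm_comp, hi, E.subTm_comp, E.subTm_comp, hpq, E.subTm_comp, E.subTm_comp])
      hi'.symm
    refine (Eq.congr_left e).trans ?_
    rw [← M.comp_pathMap p ρ _ rfl _ rfl]
    have e' : E.subTm i (a.sub (E.disp (E.cst Δ' M.I) ≫ δ)).1 =
        E.subTm (ρ ≫ M.proj Ξ ≫ τ ≫ E.into X σ a) (E.var X) := by
      refine (E.subTm_comp _ _ _).symm.trans ?_
      rw [hi, E.subTm_comp ρ, E.subTm_comp (M.proj Ξ), E.subTm_comp ρ, E.subTm_comp (M.proj Ξ),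
        E.subTm_comp τ, into_var]
    rw [e']
    refine ⟨fun h => E.ext_hom _ _ ?_ h, fun h => by rw [h]⟩
    simp only [Category.assoc, pathMap_disp, into_disp, hp]
  simp only [ConstOn, T.forced_Sig, T.forced_Pi]
  constructor
  · rintro ⟨φ, hφ, H⟩
    refine ⟨φ ≫ E.lift _ M.Cof, fun Ξ' ρ hρ => ?_⟩
    obtain ⟨t, ht⟩ := hρ
    let h : Ξ' ⟶ E.ext (M.holds (E.lift (terminal.from Δ) M.Cof)) :=
      E.pull rfl (ρ ≫ M.proj Ξ ≫ φ) t (by rw [ht]; simp only [Category.assoc])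
    have hh : h ≫ E.disp _ = ρ ≫ M.proj Ξ ≫ φ := E.pull_disp _ _ _ _
    let i : Ξ' ⟶ E.ext (E.cst (E.ext (M.holds (E.lift (terminal.from Δ) M.Cof))) M.I) :=
      E.pull rfl h (ρ ≫ E.lift (terminal.from Ξ) M.I) (Subsingleton.elim _ _)
    have hi : i ≫ E.disp _ = h := E.pull_disp _ _ _ _
    refine (key ρ (E.disp _ ≫ E.disp _) i ?_ ?_).1
      (H (ρ ≫ M.proj Ξ) h (by rw [hh, Category.assoc]) (𝟙 _) i (by rw [hi, Category.id_comp]))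
    · rw [← Category.assoc i, hi, ← Category.assoc h, hh]
      simp only [Category.assoc, hφ]
    · rw [E.subTm_comp ρ, subTm_coord, ← E.liftEq_var (terminal.from _) rfl, ← E.subTm_comp,
        pull_liftEq]
      exact (E.subTm_comp _ _ _).trans (congrArg _ (E.liftEq_var _ _))
  · rintro ⟨φ, H⟩
    let φ' : Ξ ⟶ E.ext (E.cst Δ M.Cof) := E.pull rfl τ φ (Subsingleton.elim _ _)
    have hφ : φ' ≫ E.lift _ M.Cof = φ := E.pull_liftEq _ _ _ _
    have hφ' : φ' ≫ E.disp _ = τ := E.pull_disp _ _ _ _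
    refine ⟨φ', hφ', ?_⟩
    intro Ξ' ρ h hh Ξ'' ρ' i hi
    let r : Ξ'' ⟶ M.cyl Ξ :=
      E.pull rfl (ρ' ≫ ρ) (i ≫ E.lift (terminal.from _) M.I) (Subsingleton.elim _ _)
    have hr : r ≫ M.proj Ξ = ρ' ≫ ρ := E.pull_disp _ _ _ _
    refine (key r (E.disp _ ≫ E.disp _) i ?_ ?_).2 (H r ?_)
    · rw [← Category.assoc i, hi, Category.assoc, ← Category.assoc h, hh, ← Category.assoc r, hr]
      simp only [Category.assoc, hφ']
    · rw [E.subTm_comp r, subTm_coord]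
      symm
      refine (congrArg (E.subTm r) (E.liftEq_var (terminal.from Ξ) rfl).symm).trans
        ((E.subTm_comp _ _ _).symm.trans ?_)
      refine (congrArg (fun t => E.subTm t _) (E.pull_liftEq _ _ _ _)).trans ?_
      rw [E.subTm_comp, liftEq_var]
    · refine ⟨ρ' ≫ h ≫ E.liftEq _ rfl, ?_⟩
      simp only [Category.assoc, liftEq_disp]
      rw [← Category.assoc h, hh, ← Category.assoc r, hr]
      simp only [Category.assoc, hφ]

/-- The case `σ = 𝟙` of `forced_IdTy`. -/
theorem forced_IdTy_sec {Ξ Γ : C} {X : E.Ty Γ} (a b : E.Elem X) (τ : Ξ ⟶ Γ) :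
    E.Forced (M.IdTy a b) τ ↔ M.Htpy (τ ≫ E.sec a) (τ ≫ E.sec b) := by
  have comp_sec (c : E.Elem X) :
      E.into X (E.disp (T.Arrow (E.cst Γ M.I) X)) (c.sub (E.disp (T.Arrow (E.cst Γ M.I) X))) =
        E.disp (T.Arrow (E.cst Γ M.I) X) ≫ E.sec c := by
    apply E.ext_hom
    · rw [into_disp, Category.assoc, sec_disp, Category.comp_id]
    · rw [into_var, E.subTm_comp, sec_var]; rfl
  simp only [IdTy, T.forced_Sig, T.forced_ProdTy]
  have key (p : Ξ ⟶ E.ext (T.Arrow (E.cst Γ M.I) X)) (hp : p ≫ E.disp _ = τ) (e : Bool)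
      (c : E.Elem X) :
      E.Forced (T.EqTy (M.at' ((E.gen (T.Arrow (E.cst Γ M.I) X)).cast (M.Paths_sub _ _))
        (E.cstEl _ (M.endpt e))) (c.sub (E.disp (T.Arrow (E.cst Γ M.I) X)))) p ↔
      M.face e Ξ ≫ M.pathMap p = τ ≫ E.sec c := by
    rw [T.forced_EqTy]
    have h := T.subTm_app_eq_ap (σ := E.disp (T.Arrow (E.cst Γ M.I) X)) (X := E.cst Γ M.I) (Y := X)
      (E.sub_cst _ _).symm rfl ((E.gen (T.Arrow (E.cst Γ M.I) X)).cast (M.Paths_sub _ _))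
      (E.cstEl _ (M.endpt e)) p p (M.face e Ξ ≫ M.coord (p ≫ E.disp _)) rfl
      (by rw [Category.assoc, coord_disp, ← Category.assoc, face_proj, Category.id_comp])
      rfl (by rw [subTm_face, subTm_cstEl])
    refine (Eq.congr_left h).trans ?_
    rw [← M.comp_pathMap p (M.face e Ξ) p
      (by rw [← Category.assoc, face_proj, Category.id_comp]) _ rfl]
    have h' : E.subTm p (c.sub (E.disp (T.Arrow (E.cst Γ M.I) X))).1 =
        E.subTm (τ ≫ E.sec c) (E.var X) := by
      refine (E.subTm_comp _ _ _).symm.trans ?_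
      rw [hp, E.subTm_comp, sec_var]
    rw [h']
    refine ⟨fun h => E.ext_hom _ _ ?_ h, fun h => by rw [h]⟩
    rw [Category.assoc, pathMap_disp, ← Category.assoc, face_proj, Category.id_comp,
      Category.assoc, sec_disp, Category.comp_id, hp]
  have key' (p : Ξ ⟶ E.ext (T.Arrow (E.cst Γ M.I) X)) (hp : p ≫ E.disp _ = τ) :
      E.Forced (M.ConstOn ((E.gen (T.Arrow (E.cst Γ M.I) X)).cast (M.Paths_sub _ _))
        (a.sub (E.disp (T.Arrow (E.cst Γ M.I) X)))) p ↔
      ∃ φ : Ξ ⟶ E.ext M.Cof, ∀ ⦃Ξ' : C⦄ (ρ : Ξ' ⟶ M.cyl Ξ),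
        E.Forced M.Holds (ρ ≫ M.proj Ξ ≫ φ) → ρ ≫ M.pathMap p = ρ ≫ M.proj Ξ ≫ τ ≫ E.sec a := by
    rw [M.forced_ConstOn ((E.gen (T.Arrow (E.cst Γ M.I) X)).cast (M.Paths_sub _ _))
      (a.sub (E.disp (T.Arrow (E.cst Γ M.I) X))) p p rfl rfl, comp_sec, ← Category.assoc p, hp]
  constructor
  · rintro ⟨p, hp, h₀, h₁, hφ⟩
    obtain ⟨φ, hφ⟩ := (key' p hp).1 hφ
    refine ⟨_, φ, ?_, (key p hp false a).1 h₀, (key p hp true b).1 h₁, hφ⟩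
    refine (M.pathMap_disp p).trans ((congrArg (M.proj Ξ ≫ ·) hp).trans ?_)
    rw [Category.assoc, sec_disp, Category.comp_id]
  · rintro ⟨p, φ, hp, h₀, h₁, hφ⟩
    have hp₀ : p ≫ E.disp X = M.proj Ξ ≫ τ := by
      rw [hp, Category.assoc, sec_disp, Category.comp_id]
    have e : M.pathMap (M.ofPathMap p hp₀) = p := M.pathMap_ofPathMap p hp₀
    have d := M.ofPathMap_disp p hp₀
    exact ⟨M.ofPathMap p hp₀, d, (key _ d false a).2 (by rw [e, h₀]),
      (key _ d true b).2 (by rw [e, h₁]), (key' _ d).2 ⟨φ, by rwa [e]⟩⟩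

/-- The identity type classifies homotopies. -/
theorem forced_IdTy {Ξ Δ Γ : C} {X : E.Ty Γ} {σ : Δ ⟶ Γ} (a b : E.Elem (E.sub σ X))
    (τ : Ξ ⟶ Δ) :
    E.Forced (M.IdTy a b) τ ↔ M.Htpy (τ ≫ E.into X σ a) (τ ≫ E.into X σ b) := by
  rw [forced_IdTy_sec, ← sec_lift, ← sec_lift, ← Category.assoc, ← Category.assoc]
  constructor
  · exact fun h => h.postcomp (E.lift σ X) σ (E.liftEq_disp _ _)
  · exact M.htpy_of_liftEq rfl (by rw [Category.assoc, sec_disp, Category.assoc, sec_disp])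

end Paths

end OrtonPitts

/-! ### Equivalences, propositions and null types at a stage -/

/-- Reindexing a family `x : X ⊢ F x : Y` along `t` amounts to composing `t` with the map it
defines. -/
theorem into_sub_eq {C : Type u} [Category.{v} C] {E : CwF.{w, v, u} C} {Δ Γ : C} {X Y : E.Ty Γ}
    (F : E.Elem (E.sub (E.disp X) Y)) {σ : Δ ⟶ Γ} (t : Δ ⟶ E.ext X)
    (h : E.sub t (E.sub (E.disp X) Y) = E.sub σ Y) (ht : t ≫ E.disp X = σ) :
    E.into Y σ ((F.sub t).cast h) = t ≫ E.mor F := by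
  apply E.ext_hom
  · rw [into_disp, Category.assoc, mor_disp, ht]
  · rw [into_var, E.subTm_comp]
    exact (congrArg _ (E.into_var _ _ _)).symm

namespace OrtonPitts

section Equivalences

variable {C : Type u} [Category.{v} C] [HasTerminal C] {E : CwF.{w, v, u} C} {T : TypeFormers E}
  (M : OrtonPitts T)

/-- The map `F` is an equivalence at a stage if it has there a right and a left inverse up to
homotopy. -/
theorem forced_isEquiv {Ξ Γ : C} {X Y : E.Ty Γ} (F : E.Elem (E.sub (E.disp X) Y)) (τ : Ξ ⟶ Γ) :
    E.Forced (M.isEquiv F) τ ↔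
      (∃ (g : Ξ ⟶ E.ext (T.Arrow Y X)) (_ : g ≫ E.disp _ = τ),
        ∀ ⦃Ξ' : C⦄ (ρ : Ξ' ⟶ Ξ) (y : Ξ' ⟶ E.ext Y) (hy : y ≫ E.disp Y = (ρ ≫ g) ≫ E.disp _),
          M.Htpy (T.ap (ρ ≫ g) y hy ≫ E.mor F) y) ∧
      (∃ (h : Ξ ⟶ E.ext (T.Arrow Y X)) (_ : h ≫ E.disp _ = τ),
        ∀ ⦃Ξ' : C⦄ (ρ : Ξ' ⟶ Ξ) (x : Ξ' ⟶ E.ext X) (hx : x ≫ E.disp X = (ρ ≫ h) ≫ E.disp _),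
          M.Htpy (T.ap (ρ ≫ h) (x ≫ E.mor F) (by rw [Category.assoc, mor_disp, hx])) x) := by
  -- The value of the generic function at the generic point, at the stage `y`.
  have app_gen {Z : E.Ty Γ} {Ξ' : C} (y : Ξ' ⟶ E.ext (E.sub (E.disp (T.Arrow Y X)) Z))
      (a : E.Elem (E.sub (E.disp (E.sub (E.disp (T.Arrow Y X)) Z) ≫ E.disp (T.Arrow Y X)) Y))
      (y' : Ξ' ⟶ E.ext Y)
      (hy : y' ≫ E.disp _ = (y ≫ E.disp (E.sub (E.disp (T.Arrow Y X)) Z)) ≫ E.disp _)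
      (ha : y ≫ E.into _ _ a = y') (h) :
      y ≫ E.into X (E.disp (E.sub (E.disp (T.Arrow Y X)) Z) ≫ E.disp (T.Arrow Y X))
        (T.app (((E.gen (T.Arrow Y X)).sub (E.disp (E.sub (E.disp (T.Arrow Y X)) Z))).cast h) a) =
      T.ap (y ≫ E.disp (E.sub (E.disp (T.Arrow Y X)) Z)) y' hy := by
    apply E.ext_hom
    · rw [Category.assoc, into_disp, T.ap_disp, Category.assoc]
    · rw [E.subTm_comp, into_var]
      refine T.subTm_app_eq_ap (σ := E.disp (E.sub (E.disp (T.Arrow Y X)) Z) ≫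
        E.disp (T.Arrow Y X)) rfl rfl _ _ _ _ _ (Category.assoc _ _ _) hy ?_ ?_
      · rw [E.subTm_comp]; rfl
      · rw [← ha, E.subTm_comp, into_var]
  rw [isEquiv]
  simp only [T.forced_ProdTy, T.forced_Sig, T.forced_Pi, forced_IdTy]
  refine and_congr (exists_congr fun g => ?_) (exists_congr fun g => ?_)
  · rw [exists_prop]
    refine and_congr_right fun hg => ⟨fun H Ξ' ρ y hy => ?_, fun H Ξ' ρ y hy => ?_⟩
    · let y' : Ξ' ⟶ E.ext (E.sub (E.disp (T.Arrow Y X)) Y) := E.pull rfl (ρ ≫ g) y hy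
      have := H ρ y' (E.pull_disp _ _ _ _)
      rw [into_sub_eq F _ _ (E.into_disp _ _ _), ← Category.assoc, app_gen y' _ y
        (by rw [E.pull_disp, hy]) (E.pull_liftEq _ _ _ _)] at this
      convert this using 1
      · congr 1
        exact T.ap_congr _ (E.pull_disp _ _ _ _).symm rfl
      · exact (E.pull_liftEq _ _ _ _).symm
    · have hy' : (y ≫ E.lift _ Y) ≫ E.disp Y = (y ≫ E.disp _) ≫ E.disp _ := by
        rw [Category.assoc, liftEq_disp, Category.assoc]
      rw [into_sub_eq F _ _ (E.into_disp _ _ _), ← Category.assoc,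
        app_gen y _ (y ≫ E.lift _ Y) hy' rfl]
      have := H ρ (y ≫ E.lift _ Y) (by rw [hy', hy])
      rwa [T.ap_congr _ hy.symm rfl] at this
  · rw [exists_prop]
    refine and_congr_right fun hg => ⟨fun H Ξ' ρ x hx => ?_, fun H Ξ' ρ x hx => ?_⟩
    · let x' : Ξ' ⟶ E.ext (E.sub (E.disp (T.Arrow Y X)) X) := E.pull rfl (ρ ≫ g) x hx
      have hx' : x' ≫ E.lift _ X = x := E.pull_liftEq _ _ _ _
      have := H ρ x' (E.pull_disp _ _ _ _)
      rw [app_gen x' _ (x ≫ E.mor F) (by rw [E.pull_disp, ← hx, Category.assoc, mor_disp])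
        (by
          rw [into_sub_eq F _ _ (E.into_disp _ _ _), ← Category.assoc]
          exact congrArg (· ≫ E.mor F) hx')] at this
      convert this using 1
      · exact T.ap_congr _ (E.pull_disp _ _ _ _).symm rfl
      · exact hx'.symm
    · have hx' : (x ≫ E.lift _ X) ≫ E.disp X = (x ≫ E.disp _) ≫ E.disp _ := by
        rw [Category.assoc, liftEq_disp, Category.assoc]
      rw [app_gen x _ ((x ≫ E.lift _ X) ≫ E.mor F) (by rw [Category.assoc, mor_disp, hx'])
        (by
          rw [into_sub_eq F _ _ (E.into_disp _ _ _), ← Category.assoc]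
          rfl)]
      have := H ρ (x ≫ E.lift _ X) (by rw [hx', hx])
      rwa [T.ap_congr _ hx.symm rfl] at this

/-- Any two elements of a proposition at the same stage are homotopic. -/
theorem htpy_of_isProp {Γ : C} {X : E.Ty Γ} (h : Nonempty (E.Elem (M.isProp X))) {Ξ : C}
    (x y : Ξ ⟶ E.ext X) (hxy : x ≫ E.disp X = y ≫ E.disp X) : M.Htpy x y := by
  rw [← forced_id, isProp, T.forced_Pi] at h
  let t := E.pull rfl x y hxy.symm
  have ht : t ≫ E.disp _ = x := E.pull_disp _ _ _ _
  have ht' : t ≫ E.lift _ X = y := E.pull_liftEq _ _ _ _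
  have := (T.forced_Pi _ _ _).1 (h (x ≫ E.disp X) x (Category.comp_id _).symm)
    (𝟙 _) t (by rw [ht, Category.id_comp])
  rw [forced_IdTy] at this
  have := this.postcomp (E.lift (E.disp X) X) _ (E.liftEq_disp _ _)
  convert this using 1
  · rw [← ht, Category.assoc]
    congr 1
    apply E.ext_hom
    · rw [Category.assoc, liftEq_disp, ← Category.assoc, into_disp]
    · rw [E.subTm_comp, liftEq_var, into_var]; rfl
  · rw [← ht', Category.assoc]
    congr 1
    apply E.ext_hom
    · rw [Category.assoc, liftEq_disp, ← Category.assoc, into_disp]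
    · rw [E.subTm_comp, liftEq_var, into_var]; rfl

/-- Nullity with respect to `Γ ⊢ B`, at the stage `τ : Ξ ⟶ Γ`. -/
theorem forced_isEquiv_constFun {Ξ Γ : C} (B X : E.Ty Γ) (τ : Ξ ⟶ Γ) :
    E.Forced (M.isEquiv (T.constFun B X)) τ ↔
      (∃ (g : Ξ ⟶ E.ext (T.Arrow (T.Arrow B X) X)) (_ : g ≫ E.disp _ = τ),
        ∀ ⦃Ξ' : C⦄ (ρ : Ξ' ⟶ Ξ) (f : Ξ' ⟶ E.ext (T.Arrow B X))
          (hf : f ≫ E.disp _ = (ρ ≫ g) ≫ E.disp _),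
          M.Htpy (T.ap (ρ ≫ g) f hf ≫ T.constMap B X) f) ∧
      (∃ (h : Ξ ⟶ E.ext (T.Arrow (T.Arrow B X) X)) (_ : h ≫ E.disp _ = τ),
        ∀ ⦃Ξ' : C⦄ (ρ : Ξ' ⟶ Ξ) (x : Ξ' ⟶ E.ext X) (hx : x ≫ E.disp X = (ρ ≫ h) ≫ E.disp _),
          M.Htpy (T.ap (ρ ≫ h) (x ≫ T.constMap B X)
            (by rw [Category.assoc, T.constMap_disp, hx])) x) :=
  M.forced_isEquiv (T.constFun B X) τ

theorem forced_isNull {A : E.Ty (⊤_ C)} (B : E.Ty (E.ext A)) {Γ Ξ : C} (X : E.Ty Γ) (τ : Ξ ⟶ Γ) :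
    E.Forced (M.isNull B X) τ ↔
      ∀ ⦃Ξ' : C⦄ (ρ : Ξ' ⟶ Ξ) (a : Ξ' ⟶ E.ext (E.cst Γ A)), a ≫ E.disp _ = ρ ≫ τ →
        E.Forced (M.isEquiv (T.constFun (E.sub (E.lift (terminal.from Γ) A) B)
          (E.sub (E.disp (E.cst Γ A)) X))) a :=
  T.forced_Pi _ _ _

end Equivalences

end OrtonPitts

/-! ### Discrete types -/

theorem TypeFormers.mereProp_Pi {C : Type u} [Category.{v} C] [HasTerminal C] {E : CwF.{w, v, u} C}
    (T : TypeFormers E) {Γ : C} (X : E.Ty Γ) {Y : E.Ty (E.ext X)} (hY : E.MereProp Y) :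
    E.MereProp (T.Pi X Y) := by
  rw [mereProp_iff]
  intro Δ σ
  rw [T.Pi_sub]
  have := (E.mereProp_iff _).1 hY (E.lift σ X)
  exact (Equiv.ofBijective _ (T.lam_bijective _ _)).symm.subsingleton

namespace OrtonPitts

section Discreteness

variable {C : Type u} [Category.{v} C] [HasTerminal C] {E : CwF.{w, v, u} C} {T : TypeFormers E}
  (M : OrtonPitts T)

/-- All paths in the fibres of `Γ ⊢ X` are constant: discreteness, for a type in a context. -/
def ConstPaths {Γ : C} (X : E.Ty Γ) : Prop :=
  ∀ ⦃Ξ : C⦄ (p : M.cyl Ξ ⟶ E.ext X) (σ : Ξ ⟶ Γ), p ≫ E.disp X = M.proj Ξ ≫ σ →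
    p = M.proj Ξ ≫ M.face false Ξ ≫ p

variable {M}

theorem ConstPaths.sub {Δ Γ : C} {X : E.Ty Γ} (hX : M.ConstPaths X) (σ : Δ ⟶ Γ) :
    M.ConstPaths (E.sub σ X) := by
  intro Ξ p τ hp
  apply E.pullback_ext rfl
  · simp only [Category.assoc, hp]
    rw [← Category.assoc (M.face false Ξ), face_proj, Category.id_comp]
  · simp only [Category.assoc]
    exact hX (p ≫ E.lift σ X) (τ ≫ σ)
      (by rw [Category.assoc, liftEq_disp, ← Category.assoc, hp, Category.assoc])

theorem ConstPaths.face_comp {Ξ Γ : C} {X : E.Ty Γ} (hX : M.ConstPaths X) {p : M.cyl Ξ ⟶ E.ext X}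
    {σ : Ξ ⟶ Γ} (hp : p ≫ E.disp X = M.proj Ξ ≫ σ) (e : Bool) :
    M.face e Ξ ≫ p = M.face false Ξ ≫ p := by
  rw [hX p σ hp, ← Category.assoc, face_proj, Category.id_comp, ← Category.assoc (M.face false Ξ),
    face_proj, Category.id_comp]

variable (M)

theorem cylMap_pathMap {Ξ' Ξ Γ : C} {X : E.Ty Γ} (ρ : Ξ' ⟶ Ξ)
    (p : Ξ ⟶ E.ext (T.Arrow (E.cst Γ M.I) X)) :
    M.cylMap ρ ≫ M.pathMap p = M.pathMap (ρ ≫ p) := by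
  rw [M.comp_pathMap p (M.cylMap ρ) (M.proj Ξ' ≫ ρ ≫ p)
    (by rw [← Category.assoc, cylMap_proj, Category.assoc]) _ rfl]
  exact T.ap_congr _ rfl (by rw [cylMap_coord, Category.assoc])

theorem pathMap_constMap {Ξ Γ : C} {X : E.Ty Γ} (x : Ξ ⟶ E.ext X) :
    M.pathMap (x ≫ T.constMap (E.cst Γ M.I) X) = M.proj Ξ ≫ x := by
  rw [pathMap, T.ap_congr _ (Category.assoc _ _ _).symm rfl, T.ap_constMap]

theorem pathMap_injective {Ξ Γ : C} {X : E.Ty Γ} {p q : Ξ ⟶ E.ext (T.Arrow (E.cst Γ M.I) X)}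
    (hd : p ≫ E.disp _ = q ≫ E.disp _) (h : M.pathMap p = M.pathMap q) : p = q := by
  refine T.arrow_ext hd fun Ξ' ρ i hi => ?_
  have e := M.cylPair_proj ρ i hi
  rw [← M.comp_pathMap p (M.cylPair ρ i hi) (ρ ≫ p) (by rw [← Category.assoc, e]) i
    (M.cylPair_coord ρ i hi), h]
  exact M.comp_pathMap q (M.cylPair ρ i hi) (ρ ≫ q) (by rw [← Category.assoc, e]) i
    (by rw [← hd]; exact M.cylPair_coord ρ i hi)

/-- The inverse of the map `X → X^I` is evaluation at the end point `0`. -/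
theorem discrete_iff (X : E.Ty (⊤_ C)) : M.Discrete X ↔ M.ConstPaths X := by
  constructor
  · intro (h : IsIso (T.constMap (E.cst (⊤_ C) M.I) X)) Ξ p σ hp
    have e : p = M.proj Ξ ≫ M.ofPathMap p hp ≫ inv (T.constMap (E.cst (⊤_ C) M.I) X) := by
      rw [← pathMap_constMap, Category.assoc, IsIso.inv_hom_id, Category.comp_id,
        pathMap_ofPathMap]
    rw [e, ← Category.assoc (M.face false Ξ), face_proj, Category.id_comp]
  · intro h
    refine ⟨M.face false _ ≫ M.pathMap (𝟙 _), ?_, ?_⟩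
    · change T.constMap _ X ≫ _ = _
      rw [← Category.assoc, ← face_cylMap, Category.assoc, cylMap_pathMap, Category.comp_id]
      have := M.pathMap_constMap (𝟙 (E.ext X))
      rw [Category.id_comp] at this
      rw [this, ← Category.assoc, face_proj, Category.id_comp]
    · change _ ≫ T.constMap _ X = _
      apply M.pathMap_injective (Subsingleton.elim _ _)
      rw [pathMap_constMap]
      exact (h (M.pathMap (𝟙 _)) (terminal.from _) (Subsingleton.elim _ _)).symm

/-- A discrete type is a fibration: paths in it being constant, the composite of an open box is the
given element at its end point. -/
theorem Discrete.nonempty_fib {X : E.Ty (⊤_ C)} (hX : M.Discrete X) : Nonempty (M.Fib X) := by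
  rw [discrete_iff] at hX
  refine ⟨⟨fun e {Δ} b => b.a.cast (by
    rw [Subsingleton.elim (M.face e Δ ≫ b.p) (M.face (!e) Δ ≫ b.p)]), ?_, fun _ _ _ _ _ => rfl⟩⟩
  intro e Δ b
  refine b.agree.symm.trans ?_
  let q := E.into X _ b.f
  have hq := hX.face_comp (p := q) (σ := terminal.from _) (Subsingleton.elim _ _)
  have hf : b.f.1 = E.subTm q (E.var X) := (E.into_var _ _ _).symm
  rw [hf, ← E.subTm_comp, ← E.subTm_comp, hq e, hq !e]

/-- Functions from a proposition to a type with constant paths are constant. -/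
theorem ConstPaths.ap_eq {Γ : C} {B X : E.Ty Γ}
    (hB : ∀ ⦃Ξ : C⦄ (b b' : Ξ ⟶ E.ext B), b ≫ E.disp B = b' ≫ E.disp B → M.Htpy b b')
    (hX : M.ConstPaths X) {Ξ : C} (f : Ξ ⟶ E.ext (T.Arrow B X)) (b b' : Ξ ⟶ E.ext B)
    (hb : b ≫ E.disp B = f ≫ E.disp _) (hb' : b' ≫ E.disp B = f ≫ E.disp _) :
    T.ap f b hb = T.ap f b' hb' := by
  obtain ⟨p, -, hp, h₀, h₁, -⟩ := hB b b' (hb.trans hb'.symm)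
  have hp' : p ≫ E.disp B = (M.proj Ξ ≫ f) ≫ E.disp _ := by rw [hp, hb, Category.assoc]
  have key (e : Bool) : M.face e Ξ ≫ T.ap (M.proj Ξ ≫ f) p hp' =
      T.ap f (M.face e Ξ ≫ p) (by
        rw [Category.assoc, hp', Category.assoc, ← Category.assoc, face_proj,
          Category.id_comp]) := by
    rw [T.comp_ap]
    exact T.ap_congr _ (by rw [← Category.assoc, face_proj, Category.id_comp]) rfl
  have := hX.face_comp (p := T.ap (M.proj Ξ ≫ f) p hp') (σ := f ≫ E.disp _)
    (by rw [T.ap_disp, Category.assoc]) true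
  rw [key, key] at this
  exact (T.ap_congr hb rfl h₀.symm).trans (this.symm.trans (T.ap_congr _ rfl h₁))

/-- A well-supported proposition `B` is indistinguishable from the unit type by its maps into a type
with constant paths.  A map `f` from `B` to such a type is constant, so its value is the unique `x`
with `f b = x` for all `b`, and this definite description can be eliminated into from the truncation
of `B`. -/
theorem ConstPaths.exists_inv_constMap {Γ : C} {B X : E.Ty Γ}
    (hB : ∀ ⦃Ξ : C⦄ (b b' : Ξ ⟶ E.ext B), b ≫ E.disp B = b' ≫ E.disp B → M.Htpy b b')
    (hB' : E.Forced (T.Tr B) (𝟙 Γ)) (hX : M.ConstPaths X) :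
    ∃ r : E.ext (T.Arrow B X) ⟶ E.ext X,
      r ≫ E.disp X = E.disp _ ∧ T.constMap B X ≫ r = 𝟙 _ ∧ r ≫ T.constMap B X = 𝟙 _ := by
  have tr {Ξ : C} (σ : Ξ ⟶ Γ) : E.Forced (T.Tr (E.sub σ B)) (𝟙 Ξ) := by
    rw [← T.Tr_sub, forced_sub, Category.id_comp]
    simpa only [Category.comp_id] using hB'.comp σ
  -- `D` is the context `f : B → X, x : X`, and `Z` is the type `Π (b : B), f b = x` over it.
  let d := E.disp (T.Arrow B X)
  let D := E.ext (E.sub d X)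
  let δ : D ⟶ Γ := E.disp (E.sub d X) ≫ d
  have h₁ : E.lift δ B ≫ E.disp B =
      (E.disp (E.sub δ B) ≫ E.disp (E.sub d X)) ≫ E.disp (T.Arrow B X) := by
    rw [liftEq_disp, Category.assoc]
  have h₂ : (E.disp (E.sub δ B) ≫ E.lift d X) ≫ E.disp X = T.ap _ _ h₁ ≫ E.disp X := by
    rw [T.ap_disp, Category.assoc, liftEq_disp, Category.assoc]
  let Z : E.Ty D := T.Pi (E.sub δ B) (T.eqTy (T.ap _ _ h₁) _ h₂)
  have forced_Z {Ξ : C} (s : Ξ ⟶ D) (f : Ξ ⟶ E.ext (T.Arrow B X)) (x : Ξ ⟶ E.ext X)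
      (hf : s ≫ E.disp _ = f) (hx : s ≫ E.lift d X = x) : E.Forced Z s ↔
      ∀ ⦃Ξ' : C⦄ (ρ : Ξ' ⟶ Ξ) (b : Ξ' ⟶ E.ext B) (hb : b ≫ E.disp B = (ρ ≫ f) ≫ E.disp _),
        T.ap (ρ ≫ f) b hb = ρ ≫ x := by
    subst hf hx
    simp only [Z, T.forced_Pi, T.forced_eqTy, T.comp_ap]
    constructor
    · intro H Ξ' ρ b hb
      have hb' : b ≫ E.disp B = (ρ ≫ s) ≫ δ := by rw [hb]; simp only [δ, d, Category.assoc]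
      have := H ρ (E.pull rfl (ρ ≫ s) b hb') (E.pull_disp _ _ _ _)
      rw [T.ap_congr _ (by rw [← Category.assoc, pull_disp, Category.assoc])
        (E.pull_liftEq _ _ _ _)] at this
      exact this.trans (by rw [← Category.assoc, pull_disp, Category.assoc])
    · intro H Ξ' ρ b hb
      have := H ρ (b ≫ E.lift δ B) (by
        rw [Category.assoc, liftEq_disp, ← Category.assoc, hb]; simp only [δ, d, Category.assoc])
      refine (T.ap_congr _ ?_ rfl).trans (this.trans ?_)
      · rw [← Category.assoc, hb, Category.assoc]
      · rw [← Category.assoc b, hb, Category.assoc]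
  have mere : E.MereProp (T.Sig (E.sub d X) Z) := by
    refine T.mereProp_Sig (T.mereProp_Pi _ (T.mereProp_eqTy _ _ _)) fun Ξ x x' e hx hx' => ?_
    refine E.pullback_ext rfl e ?_
    have e' : (x' ≫ E.lift d X) ≫ E.disp X = (x ≫ E.lift d X) ≫ E.disp X := by
      rw [Category.assoc, Category.assoc, liftEq_disp, ← Category.assoc, ← e, Category.assoc]
    have := T.forced_of_Tr (tr (x ≫ δ)) (T.mereProp_eqTy (x ≫ E.lift d X) (x' ≫ E.lift d X) e') ?_
    · rwa [T.forced_eqTy, Category.id_comp, Category.id_comp] at this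
    · intro Ξ' τ h
      rw [forced_sub] at h
      obtain ⟨b, hb⟩ := h
      rw [T.forced_eqTy, ← (forced_Z x _ _ rfl rfl).1 hx τ b (by
        rw [hb]; simp only [δ, d, Category.assoc]), ← (forced_Z x' _ _ e.symm rfl).1 hx' τ b]
  have inhab : E.Forced (T.Sig (E.sub d X) Z) (𝟙 _) := by
    refine T.forced_of_Tr (tr d) mere fun Ξ τ h => ?_
    rw [forced_sub] at h
    obtain ⟨b, hb⟩ := h
    rw [T.forced_Sig]
    refine ⟨E.pull rfl τ (T.ap τ b hb) (T.ap_disp _ _ _), E.pull_disp _ _ _ _, ?_⟩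
    rw [forced_Z _ τ _ (E.pull_disp _ _ _ _) (E.pull_liftEq _ _ _ _)]
    intro Ξ' ρ b' hb'
    rw [T.comp_ap]
    exact ConstPaths.ap_eq M hB hX _ _ _ _ _
  rw [T.forced_Sig] at inhab
  obtain ⟨s, hs, hZ⟩ := inhab
  rw [forced_Z s (𝟙 _) _ hs rfl] at hZ
  have hd : (s ≫ E.lift d X) ≫ E.disp X = E.disp _ := by
    rw [Category.assoc, liftEq_disp, ← Category.assoc, hs, Category.id_comp]
  refine ⟨s ≫ E.lift d X, hd, ?_, ?_⟩
  · have e : 𝟙 (E.ext X) ≫ E.disp X = (T.constMap B X ≫ s ≫ E.lift d X) ≫ E.disp X := by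
      rw [Category.id_comp, Category.assoc, hd, T.constMap_disp]
    have := T.forced_of_Tr (tr (E.disp X)) (T.mereProp_eqTy _ _ e) ?_
    · rwa [T.forced_eqTy, Category.id_comp, Category.id_comp] at this
    · intro Ξ τ h
      rw [forced_sub] at h
      obtain ⟨b, hb⟩ := h
      have hb' : b ≫ E.disp B = (τ ≫ T.constMap B X) ≫ E.disp _ := by
        rw [hb, Category.assoc, T.constMap_disp]
      rw [T.forced_eqTy, ← Category.assoc, Category.comp_id,
        ← hZ (τ ≫ T.constMap B X) b (by rw [Category.comp_id, hb']),
        T.ap_congr _ (Category.comp_id _) rfl, T.ap_constMap]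
  · refine T.arrow_ext ?_ fun Ξ ρ b hb => ?_
    · rw [Category.assoc, T.constMap_disp, hd, Category.id_comp]
    · have hb' : b ≫ E.disp B = (ρ ≫ 𝟙 _) ≫ E.disp _ := by
        rw [hb, Category.assoc, T.constMap_disp, hd, Category.comp_id]
      rw [hZ ρ b hb', T.ap_congr _ (Category.assoc _ _ _).symm rfl, T.ap_constMap]

/-- Introduction rule for `forced_isEquiv_constFun`: inverses are maps out of the context extended
by the function type. -/
theorem forced_isEquiv_constFun_of_maps {Ξ Γ : C} {B X : E.Ty Γ} {τ : Ξ ⟶ Γ}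
    (k : E.ext (E.sub τ (T.Arrow B X)) ⟶ E.ext X) (hk : k ≫ E.disp X = E.disp _ ≫ τ)
    (Hk : M.Htpy (k ≫ T.constMap B X) (E.lift τ (T.Arrow B X)))
    (l : E.ext (E.sub τ (T.Arrow B X)) ⟶ E.ext X) (hl : l ≫ E.disp X = E.disp _ ≫ τ)
    (Hl : ∀ ⦃Ξ' : C⦄ (ρ : Ξ' ⟶ E.ext (E.sub τ (T.Arrow B X))) (x : Ξ' ⟶ E.ext X),
      x ≫ T.constMap B X = ρ ≫ E.lift τ (T.Arrow B X) → M.Htpy (ρ ≫ l) x) :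
    E.Forced (M.isEquiv (T.constFun B X)) τ := by
  rw [forced_isEquiv_constFun]
  refine ⟨⟨T.curry rfl k hk, T.curry_disp _ _ _, fun Ξ' ρ f hf => ?_⟩,
    ⟨T.curry rfl l hl, T.curry_disp _ _ _, fun Ξ' ρ x hx => ?_⟩⟩
  · have hf' : f ≫ E.disp _ = ρ ≫ τ := by rw [hf, Category.assoc, T.curry_disp]
    rw [T.ap_curry rfl k hk ρ f hf', Category.assoc]
    simpa only [E.pull_liftEq] using Hk.precomp (E.pull rfl ρ f hf')
  · have hf' : (x ≫ T.constMap B X) ≫ E.disp _ = ρ ≫ τ := by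
      rw [Category.assoc, T.constMap_disp, hx, Category.assoc, T.curry_disp]
    rw [T.ap_curry rfl l hl ρ _ hf']
    exact Hl _ _ (E.pull_liftEq _ _ _ _).symm

/-- Types with constant paths are null, for a well-supported proposition `B`. -/
theorem ConstPaths.forced_isEquiv {Γ : C} {B X : E.Ty Γ}
    (hB : ∀ ⦃Ξ : C⦄ (b b' : Ξ ⟶ E.ext B), b ≫ E.disp B = b' ≫ E.disp B → M.Htpy b b')
    (hB' : E.Forced (T.Tr B) (𝟙 Γ)) (hX : M.ConstPaths X) {Ξ : C} (τ : Ξ ⟶ Γ) :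
    E.Forced (M.isEquiv (T.constFun B X)) τ := by
  obtain ⟨r, hr, h₁, h₂⟩ := ConstPaths.exists_inv_constMap M hB hB' hX
  have hd : (E.lift τ (T.Arrow B X) ≫ r) ≫ E.disp X = E.disp _ ≫ τ := by
    rw [Category.assoc, hr, liftEq_disp]
  refine M.forced_isEquiv_constFun_of_maps (E.lift τ _ ≫ r) hd ?_ (E.lift τ _ ≫ r) hd ?_
  · rw [Category.assoc, h₂, Category.comp_id]
    exact Htpy.refl M _
  · intro Ξ' ρ x hx
    rw [← Category.assoc, ← hx, Category.assoc, h₁, Category.comp_id]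
    exact Htpy.refl M _

end Discreteness

end OrtonPitts

/-! ### Sums are disjoint and extensive -/

namespace TypeFormers

section Sums

variable {C : Type u} [Category.{v} C] [HasTerminal C] {E : CwF.{w, v, u} C} (T : TypeFormers E)

/-- The two summands of `X + Y`: `X` for `false`, `Y` for `true`. -/
def side {Γ : C} (X Y : E.Ty Γ) (b : Bool) : E.Ty Γ := cond b Y X

/-- The two inclusions into a sum. -/
def inj {Γ : C} (X Y : E.Ty Γ) : ∀ b : Bool, E.ext (side X Y b) ⟶ E.ext (T.SumTy X Y)
  | false => T.inlMap X Y
  | true => T.inrMap X Y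

theorem inj_disp {Γ : C} (X Y : E.Ty Γ) (b : Bool) :
    T.inj X Y b ≫ E.disp _ = E.disp (side X Y b) := by
  cases b
  · exact T.inlMap_disp X Y
  · exact T.inrMap_disp X Y

theorem exists_desc {Γ : C} {X Y W : E.Ty Γ} (k : ∀ b, E.ext (side X Y b) ⟶ E.ext W)
    (hk : ∀ b, k b ≫ E.disp W = E.disp _) :
    ∃ t : E.ext (T.SumTy X Y) ⟶ E.ext W, t ≫ E.disp W = E.disp _ ∧ ∀ b, T.inj X Y b ≫ t = k b := by
  obtain ⟨t, ht, h₁, h₂⟩ := T.exists_sum_desc (k false) (hk false) (k true) (hk true)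
  exact ⟨t, ht, fun b => by cases b <;> assumption⟩

theorem forced_of_cases {Γ Ξ : C} {X Y : E.Ty Γ} (s : Ξ ⟶ E.ext (T.SumTy X Y)) (G : E.Ty Ξ)
    (h : ∀ (b : Bool) ⦃Ξ' : C⦄ (τ : Ξ' ⟶ Ξ) (x : Ξ' ⟶ E.ext (side X Y b)),
      x ≫ T.inj X Y b = τ ≫ s → E.Forced G τ) : E.Forced G (𝟙 Ξ) :=
  T.forced_of_sum s G (h false) (h true)

/-- The inclusions into a sum are monomorphisms: sending the elements of one summand to the constant
functions on it, and those of the other to the identity function, is a map `X + Y → (X → X)` (and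
likewise with `Y`), and a constant function determines its value at any stage where there is an
argument to apply it to. -/
theorem inj_cancel {Γ Ξ : C} {X Y : E.Ty Γ} {b : Bool} {x x' : Ξ ⟶ E.ext (side X Y b)}
    (h : x ≫ T.inj X Y b = x' ≫ T.inj X Y b) : x = x' := by
  obtain ⟨t, -, ht⟩ : ∃ t : E.ext (T.SumTy X Y) ⟶
      E.ext (T.Arrow (side X Y b) (side X Y b)), t ≫ E.disp _ = E.disp _ ∧
      T.inj X Y b ≫ t = T.constMap _ _ := by
    let idFun (Z : E.Ty Γ) : E.ext Z ⟶ E.ext (T.Arrow (side X Y b) (side X Y b)) :=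
      T.curry (σ := E.disp Z) rfl (E.lift (E.disp Z) (side X Y b)) (E.liftEq_disp _ _)
    obtain ⟨t, ht, h⟩ := T.exists_desc (X := X) (Y := Y)
      (fun b' => if e : b' = b then e ▸ T.constMap (side X Y b') (side X Y b') else idFun _) (by
        intro b'
        split_ifs with e
        · subst e; exact T.constMap_disp _ _
        · exact T.curry_disp _ _ _)
    exact ⟨t, ht, by rw [h, dif_pos rfl]⟩
  have h' : x ≫ T.constMap (side X Y b) (side X Y b) = x' ≫ T.constMap _ _ := by
    rw [← ht, ← Category.assoc, h, Category.assoc]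
  have w : x ≫ E.disp _ = (x ≫ T.constMap (side X Y b) (side X Y b)) ≫ E.disp _ := by
    rw [Category.assoc, T.constMap_disp]
  exact (T.ap_constMap x x w).symm.trans ((T.ap_congr w h' rfl).trans (T.ap_constMap _ _ _))

/-- The type of truth values, over `Γ`. -/
noncomputable abbrev two (Γ : C) : E.Ty Γ := T.SumTy (E.cst Γ T.one) (E.cst Γ T.one)

theorem ext_one_hom {Γ Ξ : C} {t t' : Ξ ⟶ E.ext (E.cst Γ T.one)}
    (h : t ≫ E.disp _ = t' ≫ E.disp _) : t = t' := by
  apply E.pullback_ext rfl h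
  obtain ⟨u⟩ := T.one_elim Ξ
  have e : terminal.from Ξ = (t' ≫ E.lift (terminal.from Γ) T.one) ≫ E.disp _ :=
    Subsingleton.elim _ _
  have : Subsingleton (E.Elem (E.sub ((t' ≫ E.lift (terminal.from Γ) T.one) ≫ E.disp _) T.one)) :=
    e ▸ u.instSubsingleton
  exact (E.into_elt _ (Subsingleton.elim _ _)).symm.trans
    ((congrArg _ (Subsingleton.elim _ _)).trans (E.into_elt _ rfl))

theorem exists_pt (Γ : C) : ∃ t : Γ ⟶ E.ext (E.cst Γ T.one), t ≫ E.disp _ = 𝟙 Γ := by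
  obtain ⟨u⟩ := T.one_elim Γ
  exact ⟨E.sec u.default, E.sec_disp _⟩

/-- The truth values `false` and `true`. -/
noncomputable def bit (Γ : C) : Bool → (Γ ⟶ E.ext (T.two Γ))
  | false => (T.exists_pt Γ).choose ≫ T.inlMap _ _
  | true => (T.exists_pt Γ).choose ≫ T.inrMap _ _

theorem bit_disp (Γ : C) (b : Bool) : T.bit Γ b ≫ E.disp _ = 𝟙 Γ := by
  have h := (T.exists_pt Γ).choose_spec
  cases b
  · rw [bit, Category.assoc, inlMap_disp, h]
  · rw [bit, Category.assoc, inrMap_disp, h]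

theorem inj_two {Γ Ξ : C} {b : Bool}
    (x : Ξ ⟶ E.ext (side (E.cst Γ T.one) (E.cst Γ T.one) b)) :
    x ≫ T.inj _ _ b = (x ≫ E.disp _) ≫ T.bit Γ b := by
  have h := (T.exists_pt Γ).choose_spec
  cases b
  · rw [bit, ← Category.assoc]
    refine congrArg (· ≫ T.inlMap _ _) (T.ext_one_hom ?_)
    rw [Category.assoc _ _ (E.disp _), h, Category.comp_id]; rfl
  · rw [bit, ← Category.assoc]
    refine congrArg (· ≫ T.inrMap _ _) (T.ext_one_hom ?_)
    rw [Category.assoc _ _ (E.disp _), h, Category.comp_id]; rfl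

/-- Case analysis on a truth value at a stage. -/
theorem forced_of_bit {Γ Ξ : C} (e : Ξ ⟶ E.ext (T.two Γ)) (G : E.Ty Ξ)
    (h : ∀ (b : Bool) ⦃Ξ' : C⦄ (τ : Ξ' ⟶ Ξ), τ ≫ e = (τ ≫ e ≫ E.disp _) ≫ T.bit Γ b →
      E.Forced G τ) : E.Forced G (𝟙 Ξ) := by
  refine T.forced_of_cases e G fun b Ξ' τ x hx => h b τ ?_
  rw [← Category.assoc τ, ← hx]
  refine (T.inj_two x).trans (congrArg (· ≫ _) ?_)
  exact (congrArg (x ≫ ·) (T.inj_disp _ _ b)).symm.trans (Category.assoc _ _ _).symm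

theorem exists_tag {Γ : C} (X Y : E.Ty Γ) : ∃ t : E.ext (T.SumTy X Y) ⟶ E.ext (T.two Γ),
    t ≫ E.disp _ = E.disp _ ∧ ∀ b, T.inj X Y b ≫ t = E.disp _ ≫ T.bit Γ b :=
  T.exists_desc _ fun b => by rw [Category.assoc, bit_disp, Category.comp_id]

/-- The map `X + Y → 2` which tells the two summands apart. -/
noncomputable def tag {Γ : C} (X Y : E.Ty Γ) : E.ext (T.SumTy X Y) ⟶ E.ext (T.two Γ) :=
  (T.exists_tag X Y).choose

theorem tag_disp {Γ : C} (X Y : E.Ty Γ) : T.tag X Y ≫ E.disp _ = E.disp _ :=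
  (T.exists_tag X Y).choose_spec.1

theorem inj_tag {Γ : C} (X Y : E.Ty Γ) (b : Bool) :
    T.inj X Y b ≫ T.tag X Y = E.disp _ ≫ T.bit Γ b :=
  (T.exists_tag X Y).choose_spec.2 b

end Sums

end TypeFormers

namespace OrtonPitts

section Sums

variable {C : Type u} [Category.{v} C] [HasTerminal C] {E : CwF.{w, v, u} C} {T : TypeFormers E}

/-- The two truth values differ.  There being no universe to eliminate into, they are separated by
mapping them to the end points of the interval. -/
theorem bot_of_bit_eq (M : OrtonPitts T) {Γ Ξ : C} (σ : Ξ ⟶ Γ) {b b' : Bool} (hb : b ≠ b')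
    (h : σ ≫ T.bit Γ b = σ ≫ T.bit Γ b') : E.Forced T.bot (terminal.from Ξ) := by
  obtain ⟨t, -, ht⟩ := T.exists_desc (X := E.cst Γ T.one) (Y := E.cst Γ T.one) (W := E.cst Γ M.I)
    (fun b => E.disp _ ≫ E.sec (E.cstEl Γ (M.endpt b)))
    (fun b => by rw [Category.assoc, sec_disp, Category.comp_id])
  obtain ⟨p, hp⟩ := T.exists_pt Γ
  have key (b : Bool) : σ ≫ T.bit Γ b ≫ t = σ ≫ E.sec (E.cstEl Γ (M.endpt b)) := by
    let x : Γ ⟶ E.ext (TypeFormers.side (E.cst Γ T.one) (E.cst Γ T.one) b) := by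
      cases b <;> exact p
    have hx : x ≫ E.disp _ = 𝟙 Γ := by cases b <;> exact hp
    have := T.inj_two x
    rw [hx, Category.id_comp] at this
    rw [← this, Category.assoc]
    refine congrArg (σ ≫ ·) ((congrArg (x ≫ ·) (ht b)).trans ?_)
    rw [← Category.assoc, hx, Category.id_comp]
  have e : σ ≫ E.sec (E.cstEl Γ (M.endpt b)) = σ ≫ E.sec (E.cstEl Γ (M.endpt b')) := by
    rw [← key, ← key, ← Category.assoc, h, Category.assoc]
  have e' := congrArg (fun t => E.subTm t (E.var _)) e
  simp only [E.subTm_comp, sec_var, subTm_cstEl] at e'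
  have e'' : (E.cstEl Ξ M.i0).1 = (E.cstEl Ξ M.i1).1 := by
    cases b <;> cases b' <;> first | exact absurd rfl hb | exact e' | exact e'.symm
  have ax2 := M.ax2
  rw [← forced_id, T.forced_NotTy] at ax2
  refine ax2 (terminal.from Ξ) ?_
  rw [T.forced_EqTy, Category.comp_id]
  exact e''

/-- Sums are extensive: an element of `X + Y` whose tag is known lies in the summand it names. -/
theorem exists_of_tag (M : OrtonPitts T) {Γ Ξ : C} {X Y : E.Ty Γ} (b : Bool)
    (s : Ξ ⟶ E.ext (T.SumTy X Y)) (h : s ≫ T.tag X Y = (s ≫ E.disp _) ≫ T.bit Γ b) :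
    ∃ x : Ξ ⟶ E.ext (TypeFormers.side X Y b), x ≫ T.inj X Y b = s := by
  let σ := s ≫ E.disp _
  let Z := E.sub σ (TypeFormers.side X Y b)
  have hZ : (E.disp Z ≫ s) ≫ E.disp _ = (E.lift σ _ ≫ T.inj X Y b) ≫ E.disp _ := by
    rw [Category.assoc, Category.assoc, T.inj_disp, liftEq_disp]
  have := T.forced_of_cases s (T.Sig Z (T.eqTy (E.lift σ _ ≫ T.inj X Y b) (E.disp Z ≫ s) hZ)) ?_
  · rw [T.forced_Sig] at this
    obtain ⟨x, hx, e⟩ := this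
    rw [T.forced_eqTy, ← Category.assoc x (E.disp Z), hx, Category.id_comp] at e
    exact ⟨x ≫ E.lift σ _, by rw [Category.assoc, e]⟩
  · intro b' Ξ' τ y hy
    have hd : y ≫ E.disp _ = τ ≫ σ := by
      rw [← T.inj_disp, ← Category.assoc, hy, Category.assoc]
    by_cases hb : b' = b
    · subst hb
      rw [T.forced_Sig]
      refine ⟨E.pull rfl τ y hd, E.pull_disp _ _ _ _, ?_⟩
      rw [T.forced_eqTy, ← Category.assoc, pull_liftEq, ← Category.assoc, pull_disp, hy]
    · refine T.forced_of_bot (M.bot_of_bit_eq (τ ≫ σ) hb ?_) _ _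
      rw [← hd, Category.assoc, ← T.inj_tag, ← Category.assoc, hy, Category.assoc, h, hd]
      simp only [σ, Category.assoc]

theorem forced_Pi_interval (M : OrtonPitts T) {Γ Δ : C} (Y : E.Ty (M.cyl Γ)) (τ : Δ ⟶ Γ) :
    E.Forced (T.Pi (E.cst Γ M.I) Y) τ ↔
      ∀ ⦃Ξ : C⦄ (ρ : Ξ ⟶ Δ) (x : Ξ ⟶ M.cyl Γ), x ≫ M.proj Γ = ρ ≫ τ → E.Forced Y x :=
  T.forced_Pi _ _ _

/-- The type of truth values is discrete, because the interval is connected: for a path `p` of truth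
values, the predicate `p i = false` on the interval is decidable. -/
theorem constPaths_two (M : OrtonPitts T) (Γ : C) : M.ConstPaths (T.two Γ) := by
  intro Ξ p σ hp
  have hP : (M.proj Ξ ≫ σ ≫ T.bit Γ false) ≫ E.disp _ = p ≫ E.disp _ := by
    simp only [Category.assoc, T.bit_disp, Category.comp_id, hp]
  have hQ : (M.proj Ξ ≫ M.face false Ξ ≫ p) ≫ E.disp _ = p ≫ E.disp _ := by
    simp only [Category.assoc, hp]
    rw [← Category.assoc (M.face _ _), face_proj, Category.id_comp]
  let P : E.Ty (M.cyl Ξ) := T.eqTy p _ hP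
  let Q : E.Ty (M.cyl Ξ) := T.eqTy p _ hQ
  -- Here `P` says that `p i = false`, and `Q` that `p i = p 0`.
  have dec : E.Forced (T.OrTy P (T.NotTy P)) (𝟙 _) := by
    refine T.forced_of_bit p _ fun b Ξ' τ hτ => ?_
    rw [hp] at hτ
    cases b
    · refine T.Or_intro_left ?_
      rw [T.forced_eqTy, hτ]; simp only [Category.assoc]
    · refine T.Or_intro_right ?_
      rw [T.forced_NotTy]
      intro Ξ'' ρ h
      rw [T.forced_eqTy, Category.assoc, hτ] at h
      refine M.bot_of_bit_eq (ρ ≫ τ ≫ M.proj Ξ ≫ σ) (b := true) (b' := false) (by decide) ?_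
      simpa only [Category.assoc] using h
  have conn := M.ax1 (Γ := Ξ) P (T.mereProp_eqTy _ _ _)
    ((T.nonempty_Pi _ _).2 ((E.forced_id _).1 dec))
  rw [← forced_id] at conn
  -- A path with the same value `b` at all points is constant.
  have const (b : Bool) {Ξ' : C} (τ : Ξ' ⟶ Ξ)
      (h : ∀ ⦃Ξ'' : C⦄ (ρ : Ξ'' ⟶ Ξ') (x : Ξ'' ⟶ M.cyl Ξ), x ≫ M.proj Ξ = ρ ≫ τ →
        x ≫ p = (x ≫ M.proj Ξ ≫ σ) ≫ T.bit Γ b) :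
      E.Forced (T.Pi (E.cst Ξ M.I) Q) τ := by
    refine (M.forced_Pi_interval _ _).2 fun Ξ'' ρ x hx => ?_
    refine (T.forced_eqTy _ _ _ _).2 ((h ρ x hx).trans ?_)
    have := h ρ (x ≫ M.proj Ξ ≫ M.face false Ξ)
      (by rw [Category.assoc, Category.assoc, face_proj, Category.comp_id, hx])
    simp only [Category.assoc] at this
    rw [← Category.assoc (M.face _ _), face_proj, Category.id_comp] at this
    rw [this]
    simp only [Category.assoc]
  have main : E.Forced (T.Pi (E.cst Ξ M.I) Q) (𝟙 Ξ) := by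
    refine T.forced_of_Or conn (T.mereProp_Pi _ (T.mereProp_eqTy _ _ _)) (fun Ξ' τ h => ?_)
      (fun Ξ' τ h => ?_)
    · refine const false τ fun Ξ'' ρ x hx => ?_
      have := (T.forced_eqTy _ _ _ _).1 ((M.forced_Pi_interval _ _).1 h ρ x hx)
      simpa only [Category.assoc] using this
    · refine const true τ fun Ξ'' ρ x hx => ?_
      have neg := (T.forced_NotTy _ _).1 ((M.forced_Pi_interval _ _).1 h ρ x hx)
      have e : ((x ≫ M.proj Ξ ≫ σ) ≫ T.bit Γ true) ≫ E.disp _ = (x ≫ p) ≫ E.disp _ := by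
        simp only [Category.assoc, T.bit_disp, Category.comp_id, hp]
      have := T.forced_of_bit (x ≫ p) (T.eqTy _ _ e) fun b Ξ₃ ρ' hρ' => ?_
      · rwa [T.forced_eqTy, Category.id_comp, Category.id_comp] at this
      · replace hρ' := hρ'.trans (by simp only [Category.assoc, reassoc_of% hp]; rfl)
        cases b
        · refine T.forced_of_bot (neg ρ' ?_) _ _
          refine (T.forced_eqTy _ _ _ _).2 ?_
          rw [Category.assoc, hρ']; simp only [Category.assoc]
        · rw [T.forced_eqTy, hρ']; simp only [Category.assoc]
  have := (M.forced_Pi_interval _ _).1 main (M.proj Ξ) (𝟙 _)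
    (by rw [Category.id_comp, Category.comp_id])
  rwa [T.forced_eqTy, Category.id_comp, Category.id_comp] at this

/-- A path in a sum which starts in a summand stays in it. -/
theorem exists_path_inj (M : OrtonPitts T) {Γ Ξ : C} {X Y : E.Ty Γ} {b : Bool}
    (p : M.cyl Ξ ⟶ E.ext (T.SumTy X Y))
    (σ : Ξ ⟶ Γ) (hp : p ≫ E.disp _ = M.proj Ξ ≫ σ) (u : Ξ ⟶ E.ext (TypeFormers.side X Y b))
    (hu : u ≫ T.inj X Y b = M.face false Ξ ≫ p) :
    ∃ q : M.cyl Ξ ⟶ E.ext (TypeFormers.side X Y b), q ≫ T.inj X Y b = p ∧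
      M.face false Ξ ≫ q = u := by
  have hd : u ≫ E.disp _ = σ := by
    rw [← T.inj_disp, ← Category.assoc, hu, Category.assoc, hp, ← Category.assoc, face_proj,
      Category.id_comp]
  have hc := M.constPaths_two Γ (p ≫ T.tag X Y) σ (by rw [Category.assoc, T.tag_disp, hp])
  obtain ⟨q, hq⟩ := M.exists_of_tag b p (by
    rw [hc, ← Category.assoc (M.face _ _), ← hu, Category.assoc u, T.inj_tag, ← Category.assoc u,
      hd, hp, Category.assoc])
  exact ⟨q, hq, T.inj_cancel (by rw [Category.assoc, hq, hu])⟩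

end Sums

end OrtonPitts

/-! ### Sums of null types -/

namespace OrtonPitts

section SumNull

variable {C : Type u} [Category.{v} C] [HasTerminal C] {E : CwF.{w, v, u} C} {T : TypeFormers E}
  (M : OrtonPitts T)

/-- The type of homotopies between two maps into `Γ.X` with the same image in `Γ`. -/
noncomputable def htpyTy {Δ Γ : C} {X : E.Ty Γ} (u v : Δ ⟶ E.ext X)
    (h : v ≫ E.disp X = u ≫ E.disp X) : E.Ty Δ :=
  M.IdTy (E.elt u rfl) (E.elt v h)

theorem forced_htpyTy {Ξ Δ Γ : C} {X : E.Ty Γ} (u v : Δ ⟶ E.ext X)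
    (h : v ≫ E.disp X = u ≫ E.disp X) (τ : Ξ ⟶ Δ) :
    E.Forced (M.htpyTy u v h) τ ↔ M.Htpy (τ ≫ u) (τ ≫ v) := by
  rw [htpyTy, forced_IdTy, into_elt, into_elt]

theorem post_inj_cancel {Ξ Γ : C} {B X Y : E.Ty Γ} {b : Bool}
    {f f' : Ξ ⟶ E.ext (T.Arrow B (TypeFormers.side X Y b))}
    (h : f ≫ T.post B (T.inj X Y b) (T.inj_disp X Y b) =
      f' ≫ T.post B (T.inj X Y b) (T.inj_disp X Y b)) : f = f' := by
  have hd : f ≫ E.disp _ = f' ≫ E.disp _ := by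
    rw [← T.post_disp B (T.inj X Y b) (T.inj_disp X Y b), ← Category.assoc, h, Category.assoc]
  refine T.arrow_ext hd fun Ξ' ρ a ha => ?_
  have w : a ≫ E.disp B = (ρ ≫ f) ≫ E.disp _ := by rw [ha, Category.assoc]
  have w' : a ≫ E.disp B = (ρ ≫ f') ≫ E.disp _ := by rw [ha, hd, Category.assoc]
  apply T.inj_cancel
  rw [← T.ap_post (T.inj X Y b) (T.inj_disp X Y b) _ _ w,
    ← T.ap_post (T.inj X Y b) (T.inj_disp X Y b) _ _ w']
  exact T.ap_congr _ (by rw [Category.assoc, h, Category.assoc]) rfl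

/-- The `B`-null types are closed under binary sums, for a well-supported proposition `B`.  A
function `f` from `B` to `X + Y` has a constant tag, by `ConstPaths.exists_inv_constMap` for the
type of truth values; so `f` lands in a single summand, where an inverse image is provided by the
nullity of that summand. -/
theorem forced_isEquiv_constFun_sum {Γ Ξ : C} {B X Y : E.Ty Γ}
    (hB : ∀ ⦃Ξ : C⦄ (b b' : Ξ ⟶ E.ext B), b ≫ E.disp B = b' ≫ E.disp B → M.Htpy b b')
    (hB' : E.Forced (T.Tr B) (𝟙 Γ)) {τ : Ξ ⟶ Γ}
    (hX : E.Forced (M.isEquiv (T.constFun B X)) τ) (hY : E.Forced (M.isEquiv (T.constFun B Y)) τ) :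
    E.Forced (M.isEquiv (T.constFun B (T.SumTy X Y))) τ := by
  have hXY : ∀ b, E.Forced (M.isEquiv (T.constFun B (TypeFormers.side X Y b))) τ := by
    intro b; cases b <;> assumption
  obtain ⟨r, hr, h₁, h₂⟩ :=
    ConstPaths.exists_inv_constMap M hB hB' (M.constPaths_two Γ)
  -- The tag `e f` of a function `f` from `B` to `X + Y`.
  let e : E.ext (T.Arrow B (T.SumTy X Y)) ⟶ E.ext (T.two Γ) :=
    T.post B (T.tag X Y) (T.tag_disp X Y) ≫ r
  have he : e ≫ T.constMap B (T.two Γ) = T.post B (T.tag X Y) (T.tag_disp X Y) := by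
    rw [Category.assoc, h₂, Category.comp_id]
  have he' : T.constMap B (T.SumTy X Y) ≫ e = T.tag X Y := by
    rw [← Category.assoc, T.constMap_post, Category.assoc, h₁, Category.comp_id]
  have hed : e ≫ E.disp _ = E.disp _ := by rw [Category.assoc, hr, T.post_disp]
  -- A function with the tag `b` factors through the summand named `b`.
  have factor (b : Bool) {Ξ : C} (f : Ξ ⟶ E.ext (T.Arrow B (T.SumTy X Y)))
      (hf : f ≫ e = (f ≫ E.disp _) ≫ T.bit Γ b) :
      ∃ u : Ξ ⟶ E.ext (T.Arrow B (TypeFormers.side X Y b)),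
        u ≫ T.post B (T.inj X Y b) (T.inj_disp X Y b) = f := by
    let σ := f ≫ E.disp _
    have w : E.lift σ B ≫ E.disp B = (E.disp (E.sub σ B) ≫ f) ≫ E.disp _ := by
      rw [liftEq_disp, Category.assoc]
    obtain ⟨k, hk⟩ := M.exists_of_tag b (T.ap (E.disp (E.sub σ B) ≫ f) (E.lift σ B) w) (by
      have w' : E.lift σ B ≫ E.disp B =
          ((E.disp (E.sub σ B) ≫ f ≫ e) ≫ T.constMap B (T.two Γ)) ≫ E.disp _ := by
        rw [w]; simp only [Category.assoc, T.constMap_disp, hed]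
      rw [← T.ap_post (T.tag X Y) (T.tag_disp X Y) _ _ w, T.ap_disp]
      refine (T.ap_congr _ ?_ rfl).trans ((T.ap_constMap _ _ w').trans ?_)
      · simp only [Category.assoc, he]
      · rw [hf]; simp only [Category.assoc])
    have hkd : k ≫ E.disp _ = E.disp _ ≫ σ := by
      rw [← T.inj_disp, ← Category.assoc, hk, T.ap_disp, Category.assoc]
    refine ⟨T.curry rfl k hkd, T.arrow_ext ?_ fun Ξ' ρ a ha => ?_⟩
    · rw [Category.assoc, T.post_disp, T.curry_disp]
    · have ha' : a ≫ E.disp B = ρ ≫ σ := by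
        rw [ha, Category.assoc, T.post_disp, T.curry_disp]
      have w' : a ≫ E.disp B = (ρ ≫ T.curry rfl k hkd) ≫ E.disp _ := by
        rw [ha', Category.assoc, T.curry_disp]
      refine (T.ap_congr _ (Category.assoc _ _ _).symm rfl).trans
        ((T.ap_post (T.inj X Y b) (T.inj_disp X Y b) _ _ w').trans ?_)
      rw [T.ap_curry rfl k hkd ρ a ha', Category.assoc, hk, T.comp_ap]
      exact T.ap_congr _ (by rw [← Category.assoc, pull_disp]) (E.pull_liftEq _ _ _ _)
  -- The generic function at the stage `τ`.
  let π := E.disp (E.sub τ (T.Arrow B (T.SumTy X Y)))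
  let f := E.lift τ (T.Arrow B (T.SumTy X Y))
  have hf : f ≫ E.disp _ = π ≫ τ := E.liftEq_disp _ _
  let D := E.sub (π ≫ τ) (T.SumTy X Y)
  let s := E.lift (π ≫ τ) (T.SumTy X Y)
  have hs : s ≫ E.disp (T.SumTy X Y) = E.disp D ≫ π ≫ τ := E.liftEq_disp _ _
  have hfs : (E.disp D ≫ f) ≫ E.disp _ = (s ≫ T.constMap B (T.SumTy X Y)) ≫ E.disp _ := by
    rw [Category.assoc, hf, Category.assoc, T.constMap_disp, hs]
  -- A right inverse chooses an element `s` whose constant function is homotopic to `f`.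
  have hg : E.Forced (T.Sig D (M.htpyTy (s ≫ T.constMap B (T.SumTy X Y)) (E.disp D ≫ f) hfs))
      (𝟙 _) := by
    refine T.forced_of_bit (f ≫ e) _ fun b Ξ' ρ hρ => ?_
    obtain ⟨⟨g, hg, H⟩, -⟩ := (M.forced_isEquiv_constFun _ _ _).1 (hXY b)
    obtain ⟨u, hu⟩ := factor b (ρ ≫ f) (by
      rw [Category.assoc, hρ]; simp only [Category.assoc, hed])
    have hud : u ≫ E.disp _ = ((ρ ≫ π) ≫ g) ≫ E.disp _ := by
      rw [← T.post_disp B (T.inj X Y b) (T.inj_disp X Y b), ← Category.assoc, hu]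
      simp only [Category.assoc, hf, hg]
    have hx : (T.ap ((ρ ≫ π) ≫ g) u hud ≫ T.inj X Y b) ≫ E.disp (T.SumTy X Y) = ρ ≫ π ≫ τ := by
      rw [Category.assoc, T.inj_disp, T.ap_disp]; simp only [Category.assoc, hg]
    rw [T.forced_Sig]
    refine ⟨E.pull rfl ρ _ hx, E.pull_disp _ _ _ _, ?_⟩
    rw [forced_htpyTy, ← Category.assoc, E.pull_liftEq, ← Category.assoc, pull_disp, ← hu,
      Category.assoc, ← T.constMap_post B (T.inj X Y b) (T.inj_disp X Y b), ← Category.assoc]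
    exact (H (ρ ≫ π) u hud).postcomp _ (𝟙 _) (by rw [T.post_disp, Category.comp_id])
  -- A left inverse chooses an element `s` homotopic to every `x` whose constant function is `f`;
  -- the type `Z` over `D` states this property of `s`.
  let D' := E.sub (E.disp D ≫ π ≫ τ) (T.SumTy X Y)
  let x := E.lift (E.disp D ≫ π ≫ τ) (T.SumTy X Y)
  have hx : x ≫ E.disp (T.SumTy X Y) = E.disp D' ≫ E.disp D ≫ π ≫ τ := E.liftEq_disp _ _
  have hfx : (E.disp D' ≫ E.disp D ≫ f) ≫ E.disp _ =
      (x ≫ T.constMap B (T.SumTy X Y)) ≫ E.disp _ := by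
    simp only [Category.assoc, hf, T.constMap_disp, hx]
  have hxy : x ≫ E.disp (T.SumTy X Y) = (E.disp D' ≫ s) ≫ E.disp (T.SumTy X Y) := by
    rw [Category.assoc, hs, hx]
  let Q := T.eqTy (x ≫ T.constMap B (T.SumTy X Y)) (E.disp D' ≫ E.disp D ≫ f) hfx
  let Z := T.Pi D' (T.Arrow Q (M.htpyTy (E.disp D' ≫ s) x hxy))
  have forced_Z {Ξ' : C} (d : Ξ' ⟶ E.ext D) : E.Forced Z d ↔
      ∀ ⦃Ξ'' : C⦄ (ρ : Ξ'' ⟶ Ξ') (z : Ξ'' ⟶ E.ext (T.SumTy X Y)),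
        z ≫ T.constMap B (T.SumTy X Y) = ρ ≫ d ≫ E.disp D ≫ f → M.Htpy (ρ ≫ d ≫ s) z := by
    simp only [Z, Q, T.forced_Pi, T.forced_Arrow, T.forced_eqTy, forced_htpyTy]
    constructor
    · intro H Ξ'' ρ z hz
      have hz' : z ≫ E.disp (T.SumTy X Y) = (ρ ≫ d) ≫ E.disp D ≫ π ≫ τ := by
        rw [← T.constMap_disp B (T.SumTy X Y), ← Category.assoc, hz]; simp only [Category.assoc, hf]
      have h := H ρ (E.pull rfl (ρ ≫ d) z hz') (E.pull_disp _ _ _ _) (𝟙 _) (by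
        rw [Category.id_comp, ← Category.assoc, E.pull_liftEq, hz,
          ← Category.assoc (E.pull rfl (ρ ≫ d) z hz') (E.disp D'), pull_disp, Category.assoc])
      rw [Category.id_comp, E.pull_liftEq, ← Category.assoc, pull_disp, Category.assoc] at h
      exact h
    · intro H Ξ'' ρ z hz Ξ₃ ρ' e
      have := H (ρ' ≫ ρ) (ρ' ≫ z ≫ x) (by
        simp only [Category.assoc] at e ⊢
        rw [reassoc_of% hz] at e
        exact e)
      rw [Category.assoc, ← Category.assoc z, hz]
      simpa only [Category.assoc] using this
  have hh : E.Forced (T.Sig D Z) (𝟙 _) := by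
    refine T.forced_of_bit (f ≫ e) _ fun b Ξ' ρ hρ => ?_
    obtain ⟨-, ⟨h, hh, H⟩⟩ := (M.forced_isEquiv_constFun _ _ _).1 (hXY b)
    obtain ⟨u, hu⟩ := factor b (ρ ≫ f) (by
      rw [Category.assoc, hρ]; simp only [Category.assoc, hed])
    have hud : u ≫ E.disp _ = ((ρ ≫ π) ≫ h) ≫ E.disp _ := by
      rw [← T.post_disp B (T.inj X Y b) (T.inj_disp X Y b), ← Category.assoc, hu]
      simp only [Category.assoc, hf, hh]
    have hx : (T.ap ((ρ ≫ π) ≫ h) u hud ≫ T.inj X Y b) ≫ E.disp (T.SumTy X Y) = ρ ≫ π ≫ τ := by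
      rw [Category.assoc, T.inj_disp, T.ap_disp]; simp only [Category.assoc, hh]
    rw [T.forced_Sig]
    refine ⟨E.pull rfl ρ _ hx, E.pull_disp _ _ _ _, ?_⟩
    rw [forced_Z]
    intro Ξ'' ρ' z hz
    rw [← Category.assoc _ (E.disp D), pull_disp, ← hu] at hz
    have hzd : z ≫ E.disp (T.SumTy X Y) = ρ' ≫ ρ ≫ π ≫ τ := by
      rw [← T.constMap_disp B (T.SumTy X Y), ← Category.assoc, hz, hu]
      simp only [Category.assoc, hf]
    obtain ⟨y, rfl⟩ := M.exists_of_tag b z (by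
      rw [← he', ← Category.assoc, hz, hu, Category.assoc, Category.assoc, hρ, hzd]
      simp only [Category.assoc, hed, hf])
    have hy : y ≫ T.constMap B _ = ρ' ≫ u := by
      apply post_inj_cancel
      rw [Category.assoc, T.constMap_post, ← Category.assoc, hz, Category.assoc]
    have hyd : y ≫ E.disp _ = (ρ' ≫ (ρ ≫ π) ≫ h) ≫ E.disp _ := by
      rw [← T.inj_disp, ← Category.assoc, hzd]; simp only [Category.assoc, hh]
    rw [E.pull_liftEq, ← Category.assoc, T.comp_ap]
    have := H (ρ' ≫ ρ ≫ π) y (by rw [hyd]; simp only [Category.assoc])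
    rw [T.ap_congr _ (Category.assoc _ _ _) hy] at this
    exact this.postcomp (T.inj X Y b) (𝟙 _) (by rw [T.inj_disp, Category.comp_id])
  rw [T.forced_Sig] at hg hh
  obtain ⟨k, hk, Hk⟩ := hg
  obtain ⟨l, hl, Hl⟩ := hh
  rw [forced_htpyTy, ← Category.assoc, ← Category.assoc, hk, Category.id_comp] at Hk
  rw [forced_Z] at Hl
  refine M.forced_isEquiv_constFun_of_maps (k ≫ s) ?_ Hk (l ≫ s) ?_ fun Ξ' ρ z hz => ?_
  · rw [Category.assoc, hs, ← Category.assoc, hk, Category.id_comp]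
  · rw [Category.assoc, hs, ← Category.assoc, hl, Category.id_comp]
  · refine Hl ρ z ?_
    rw [hz, ← Category.assoc l, hl, Category.id_comp]

end SumNull

end OrtonPitts

/-! ### The natural numbers and the empty type -/

namespace TypeFormers

section Nat

variable {C : Type u} [Category.{v} C] [HasTerminal C] {E : CwF.{w, v, u} C} (T : TypeFormers E)

/-- The type of natural numbers, weakened to the terminal context: the instance to which `nat_elim`
applies. -/
noncomputable abbrev natTop : E.Ty (⊤_ C) := E.cst (⊤_ C) T.nat

/-- Zero, as a map out of the terminal context. -/
noncomputable def zeroMap : ⊤_ C ⟶ E.ext T.natTop := E.sec (E.cstEl (⊤_ C) T.zero)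

/-- The successor, as an endomap of the context of natural numbers. -/
noncomputable def succMap : E.ext T.natTop ⟶ E.ext T.natTop :=
  E.mor ((T.succ.sub (E.lift (terminal.from (⊤_ C)) T.nat)).cast
    ((E.sub_cst _ T.nat).trans (E.sub_cst _ T.nat).symm))

theorem exists_nat_elim (Z : E.Ty (E.ext T.natTop)) (k₀ : ⊤_ C ⟶ E.ext Z)
    (h₀ : k₀ ≫ E.disp Z = T.zeroMap) (k₁ : E.ext Z ⟶ E.ext Z)
    (h₁ : k₁ ≫ E.disp Z = E.disp Z ≫ T.succMap) :
    ∃ t : E.ext T.natTop ⟶ E.ext Z,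
      t ≫ E.disp Z = 𝟙 _ ∧ T.zeroMap ≫ t = k₀ ∧ T.succMap ≫ t = t ≫ k₁ := by
  obtain ⟨t, ⟨e₀, e₁⟩, -⟩ := T.nat_elim Z (E.elt k₀ h₀) (E.elt k₁ h₁)
  refine ⟨E.sec t, E.sec_disp t, E.ext_hom _ _ ?_ ?_, E.ext_hom _ _ ?_ ?_⟩
  · rw [Category.assoc, sec_disp, Category.comp_id, h₀]
  · rw [E.subTm_comp, sec_var]
    exact congrArg Subtype.val e₀
  · rw [Category.assoc, sec_disp, Category.comp_id, Category.assoc, h₁, ← Category.assoc, sec_disp,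
      Category.id_comp]
  · rw [E.subTm_comp, sec_var, E.subTm_comp]
    exact e₁

theorem exists_nat_cases (W : E.Ty (⊤_ C)) (k₀ : ⊤_ C ⟶ E.ext W) (k₁ : E.ext T.natTop ⟶ E.ext W) :
    ∃ t : E.ext T.natTop ⟶ E.ext W, T.zeroMap ≫ t = k₀ ∧ T.succMap ≫ t = k₁ := by
  let Z := E.sub (E.disp T.natTop) W
  obtain ⟨t, ht, h₀, h₁⟩ := T.exists_nat_elim Z
    (E.pull rfl T.zeroMap k₀ (Subsingleton.elim _ _)) (E.pull_disp _ _ _ _)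
    (E.pull rfl (E.disp Z ≫ T.succMap) (E.disp Z ≫ k₁) (Subsingleton.elim _ _))
    (E.pull_disp _ _ _ _)
  refine ⟨t ≫ E.lift _ W, ?_, ?_⟩
  · rw [← Category.assoc, h₀, pull_liftEq]
  · rw [← Category.assoc, h₁, Category.assoc, pull_liftEq, ← Category.assoc, ht, Category.id_comp]

/-- The principle of induction. -/
theorem forced_of_nat (Z : E.Ty (E.ext T.natTop)) (h₀ : E.Forced Z T.zeroMap)
    (h₁ : E.Forced Z (E.disp Z ≫ T.succMap)) : E.Forced Z (𝟙 _) := by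
  obtain ⟨k₀, h₀⟩ := h₀
  obtain ⟨k₁, h₁⟩ := h₁
  obtain ⟨t, ht, -⟩ := T.exists_nat_elim Z k₀ h₀ k₁ h₁
  exact ⟨t, ht⟩

/-- The natural numbers are a retract of `1 + ℕ` along the predecessor map. -/
theorem exists_pred : ∃ (t : ⊤_ C ⟶ E.ext (E.cst (⊤_ C) T.one))
    (d : E.ext T.natTop ⟶ E.ext (T.SumTy (E.cst (⊤_ C) T.one) T.natTop))
    (c : E.ext (T.SumTy (E.cst (⊤_ C) T.one) T.natTop) ⟶ E.ext T.natTop),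
    T.zeroMap ≫ d = t ≫ T.inlMap _ _ ∧ T.succMap ≫ d = T.inrMap _ _ ∧
      T.inlMap _ _ ≫ c = E.disp (E.cst (⊤_ C) T.one) ≫ T.zeroMap ∧
      T.inrMap _ _ ≫ c = T.succMap ∧ d ≫ c = 𝟙 _ := by
  obtain ⟨t, ht⟩ := T.exists_pt (⊤_ C)
  obtain ⟨d, d₀, d₁⟩ := T.exists_nat_cases _
    (t ≫ T.inlMap (E.cst (⊤_ C) T.one) T.natTop) (T.inrMap (E.cst (⊤_ C) T.one) T.natTop)
  obtain ⟨c, -, c₀, c₁⟩ := T.exists_sum_desc (X := E.cst (⊤_ C) T.one) (Y := T.natTop)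
    (E.disp _ ≫ T.zeroMap) (Subsingleton.elim _ _) T.succMap (Subsingleton.elim _ _)
  refine ⟨t, d, c, d₀, d₁, c₀, c₁, ?_⟩
  have := T.forced_of_nat (T.eqTy (d ≫ c) (𝟙 _) (Subsingleton.elim _ _)) ?_ ?_
  · rwa [T.forced_eqTy, Category.id_comp, Category.id_comp] at this
  · rw [T.forced_eqTy, Category.comp_id, ← Category.assoc, d₀, Category.assoc, c₀, ← Category.assoc,
      ht, Category.id_comp]
  · rw [T.forced_eqTy, Category.comp_id]
    exact (Category.assoc _ _ _).trans
      (congrArg (E.disp _ ≫ ·) ((Category.assoc _ _ _).symm.trans (by rw [d₁, c₁])))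

end Nat

theorem WellSupported.sub {C : Type u} [Category.{v} C] [HasTerminal C] {E : CwF.{w, v, u} C}
    {T : TypeFormers E} {Δ Γ : C} {B : E.Ty Γ} (hB : T.WellSupported B) (σ : Δ ⟶ Γ) :
    E.Forced (T.Tr (E.sub σ B)) (𝟙 Δ) := by
  rw [← T.Tr_sub, forced_sub, Category.id_comp, ← Category.comp_id σ]
  exact ((E.forced_id _).2 hB).comp σ

end TypeFormers

namespace OrtonPitts

section Nat

variable {C : Type u} [Category.{v} C] [HasTerminal C] {E : CwF.{w, v, u} C} {T : TypeFormers E}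
  (M : OrtonPitts T)

/-- For a closed type `X`, the statement that all paths in `X` with starting point `x` are constant
can be expressed by a type in context `x : X`. -/
theorem exists_constPathsFrom (X : E.Ty (⊤_ C)) : ∃ Z : E.Ty (E.ext X),
    ∀ ⦃Ξ : C⦄ (x : Ξ ⟶ E.ext X), E.Forced Z x ↔
      ∀ ⦃Ξ' : C⦄ (ρ : Ξ' ⟶ Ξ) (p : M.cyl Ξ' ⟶ E.ext X), M.face false Ξ' ≫ p = ρ ≫ x →
        p = M.proj Ξ' ≫ ρ ≫ x := by
  let W := E.sub (E.disp X) (T.Arrow (E.cst (⊤_ C) M.I) X)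
  let v : E.ext W ⟶ _ := E.lift (E.disp X) (T.Arrow (E.cst (⊤_ C) M.I) X)
  have face_v {Ξ : C} (t : Ξ ⟶ E.ext W) :
      t ≫ M.face false _ ≫ M.pathMap v = M.face false Ξ ≫ M.pathMap (t ≫ v) := by
    rw [← Category.assoc, ← M.face_cylMap, Category.assoc, M.cylMap_pathMap]
  refine ⟨T.Pi W (T.Arrow
    (T.eqTy (M.face false _ ≫ M.pathMap v) (E.disp W) (Subsingleton.elim _ _))
    (T.eqTy v (E.disp W ≫ T.constMap _ X) (Subsingleton.elim _ _))), fun Ξ x => ?_⟩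
  simp only [T.forced_Pi, T.forced_Arrow, T.forced_eqTy]
  constructor
  · intro H Ξ' ρ p hp
    let k := M.ofPathMap (σ := terminal.from Ξ') p (Subsingleton.elim _ _)
    have hk : M.pathMap k = p := M.pathMap_ofPathMap _ _
    let t := E.pull (X' := W) (σ := E.disp X) rfl (ρ ≫ x) k (Subsingleton.elim _ _)
    have ht : t ≫ E.disp W = ρ ≫ x := E.pull_disp _ _ _ _
    have ht' : t ≫ v = k := E.pull_liftEq _ _ _ _
    have := H ρ t ht (𝟙 _) (by rw [Category.id_comp, face_v, ht', hk, ht, hp])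
    rw [Category.id_comp, ht', ← Category.assoc, ht] at this
    rw [← hk, this, pathMap_constMap]
  · intro H Ξ' ρ t ht Ξ'' ρ' e
    rw [face_v] at e
    have e' : (ρ' ≫ t) ≫ E.disp W = (ρ' ≫ ρ) ≫ x := by rw [Category.assoc, ht, Category.assoc]
    apply M.pathMap_injective (Subsingleton.elim _ _)
    rw [← Category.assoc _ (E.disp W), pathMap_constMap, e']
    exact H _ _ (e.trans e')

/-- The natural numbers are discrete: by induction on its starting point, a path of natural numbers
is constant.  A path which starts at zero (a successor) is taken by the predecessor map to a path in
the left (right) summand of `1 + ℕ`. -/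
theorem discrete_nat : M.Discrete T.nat := by
  obtain ⟨t, d, c, d₀, d₁, c₀, c₁, hdc⟩ := T.exists_pred
  obtain ⟨Z, hZ⟩ := M.exists_constPathsFrom T.natTop
  have left {Ξ : C} (p : M.cyl Ξ ⟶ E.ext (T.SumTy (E.cst (⊤_ C) T.one) T.natTop))
      (u : Ξ ⟶ E.ext (E.cst (⊤_ C) T.one)) (hu : u ≫ T.inlMap _ _ = M.face false Ξ ≫ p) :
      ∃ q : M.cyl Ξ ⟶ E.ext (E.cst (⊤_ C) T.one), q ≫ T.inlMap _ _ = p := by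
    obtain ⟨q, hq, -⟩ := M.exists_path_inj (b := false) p (terminal.from _)
      (Subsingleton.elim _ _) u hu
    exact ⟨q, hq⟩
  have right {Ξ : C} (p : M.cyl Ξ ⟶ E.ext (T.SumTy (E.cst (⊤_ C) T.one) T.natTop))
      (u : Ξ ⟶ E.ext T.natTop) (hu : u ≫ T.inrMap _ _ = M.face false Ξ ≫ p) :
      ∃ q : M.cyl Ξ ⟶ E.ext T.natTop, q ≫ T.inrMap _ _ = p ∧ M.face false Ξ ≫ q = u :=
    M.exists_path_inj (b := true) p (terminal.from _) (Subsingleton.elim _ _) u hu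
  have key : E.Forced Z (𝟙 _) := by
    refine T.forced_of_nat Z ((hZ _).2 fun Ξ ρ p hp => ?_) ((hZ _).2 fun Ξ ρ p hp => ?_)
    · obtain ⟨q, hq⟩ := left (p ≫ d) (ρ ≫ t)
        (by rw [Category.assoc, ← d₀, ← Category.assoc, ← hp, Category.assoc])
      rw [← Category.comp_id p, ← hdc, ← Category.assoc, ← hq, Category.assoc, c₀, ← Category.assoc,
        ← Category.assoc, Subsingleton.elim (q ≫ _) (M.proj Ξ ≫ ρ)]
    · obtain ⟨q, hq, hq'⟩ := right (p ≫ d) (ρ ≫ E.disp Z)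
        (by rw [← d₁, ← Category.assoc, Category.assoc ρ, ← hp, Category.assoc])
      rw [← Category.comp_id p, ← hdc, ← Category.assoc, ← hq, Category.assoc, c₁,
        (hZ _).1 ⟨𝟙 _, Category.id_comp (E.disp Z)⟩ ρ q hq']
      simp only [Category.assoc]
  rw [discrete_iff]
  intro Ξ p σ hp
  let p' := E.pull (X' := T.natTop) rfl (terminal.from _) p (Subsingleton.elim _ _)
  have hp' : p' ≫ E.lift _ T.nat = p := E.pull_liftEq _ _ _ _
  have := (hZ _).1 key (M.face false Ξ ≫ p') p' (Category.comp_id _).symm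
  rw [Category.comp_id] at this
  rw [← hp', ← Category.assoc (M.face _ _), ← Category.assoc, ← this]

/-- A path in the empty type makes its own stage inconsistent. -/
theorem discrete_bot : M.Discrete T.bot := by
  rw [discrete_iff]
  intro Ξ p σ hp
  exact T.eq_of_bot ⟨p, rfl⟩ (Subsingleton.elim _ _)

end Nat

/-! ### Nullity -/

section Null

variable {C : Type u} [Category.{v} C] [HasTerminal C] {E : CwF.{w, v, u} C} {T : TypeFormers E}
  (M : OrtonPitts T) {A : E.Ty (⊤_ C)} {B : E.Ty (E.ext A)}

/-- The instances of a proposition are propositions. -/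
theorem htpy_sub_of_isProp (hprop : Nonempty (E.Elem (M.isProp B))) {Δ : C} (σ : Δ ⟶ E.ext A)
    ⦃Ξ : C⦄ (b b' : Ξ ⟶ E.ext (E.sub σ B)) (h : b ≫ E.disp _ = b' ≫ E.disp _) : M.Htpy b b' :=
  M.htpy_of_liftEq rfl h (M.htpy_of_isProp hprop _ _ (by
    rw [Category.assoc, Category.assoc, liftEq_disp, ← Category.assoc, h, Category.assoc]))

theorem Discrete.nonempty_isNull {X : E.Ty (⊤_ C)} (hX : M.Discrete X)
    (hprop : Nonempty (E.Elem (M.isProp B))) (hB : T.WellSupported B) :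
    Nonempty (E.Elem (M.isNull B X)) := by
  rw [discrete_iff] at hX
  rw [← forced_id, forced_isNull]
  exact fun Ξ ρ a _ => ConstPaths.forced_isEquiv M (M.htpy_sub_of_isProp hprop _)
    (hB.sub _) (hX.sub _) a

theorem nonempty_isNull_sum (hprop : Nonempty (E.Elem (M.isProp B))) (hB : T.WellSupported B)
    {Γ : C} (X Y : E.Ty Γ) :
    Nonempty (E.Elem (T.Arrow (M.isNull B X) (T.Arrow (M.isNull B Y)
      (M.isNull B (T.SumTy X Y))))) := by
  rw [← forced_id, T.forced_Arrow]
  intro Ξ ρ hX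
  rw [T.forced_Arrow]
  intro Ξ' ρ' hY
  replace hX := hX.comp ρ'
  rw [forced_isNull] at hX hY ⊢
  intro Ξ'' ρ'' a ha
  rw [T.SumTy_sub]
  exact M.forced_isEquiv_constFun_sum (M.htpy_sub_of_isProp hprop _) (hB.sub _)
    (hX ρ'' a ha) (hY ρ'' a ha)

end Null

end OrtonPitts

end CwF

theorem mainTheorem11 {C : Type u} [Category.{v} C] [HasTerminal C] (E : CwF.{w, v, u} C)
    (T : E.TypeFormers) (hE : E.Democratic) (M : CwF.OrtonPitts T)
    (A : M.FibTy (⊤_ C)) (B : M.FibTy (E.ext A.ty))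
    (hprop : Nonempty (E.Elem (M.isProp B.ty))) (hB : T.WellSupported B.ty) :
    (∀ X : E.Ty (⊤_ C), M.Discrete X →
      Nonempty (M.Fib X) ∧ Nonempty (E.Elem (M.isNull B.ty X))) ∧
    (M.Discrete T.nat ∧ Nonempty (E.Elem (M.isNull B.ty T.nat))) ∧
    (M.Discrete T.bot ∧ Nonempty (E.Elem (M.isNull B.ty T.bot))) ∧
    (∀ (Γ : C) (X Y : M.FibTy Γ),
      Nonempty (E.Elem (T.Arrow (M.isNull B.ty X.ty)
        (T.Arrow (M.isNull B.ty Y.ty) (M.isNull B.ty (T.SumTy X.ty Y.ty)))))) := by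
  exact ⟨fun X hX => ⟨hX.nonempty_fib M, hX.nonempty_isNull M hprop hB⟩,
    ⟨M.discrete_nat, M.discrete_nat.nonempty_isNull M hprop hB⟩,
    ⟨M.discrete_bot, M.discrete_bot.nonempty_isNull M hprop hB⟩,
    fun Γ X Y => M.nonempty_isNull_sum hprop hB X.ty Y.ty⟩
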